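/- Let $H$ be a separable infinite-dimensional (real or complex) Hilbert space, let $A$ be a bounded self-adjoint operator on $H$ with $\inf_{\|x\|=1}\langle Ax,x\rangle>0$, and let $E=\{x\in H:\langle x,Ax\rangle\le 1\}$ be the ellipsoid generated by $A$. Call a subset $M$ of a normed space $X$ *linearly expand-contract plastic* (LEC-plastic) if every linear operator $T:X\to X$ whose restriction to $M$ is a non-expansive bijection from $M$ onto $M$ is an isometry on $M$. For $\psi\in H$ let $\mu_\psi$ be the spectral measure of $A$ at $\psi$, i.e. the finite Borel measure on $\sigma(A)$ with $\langle\psi,f(A)\psi\rangle=\int f\,d\mu_\psi$ for all continuous $f$ on $\sigma(A)$ (equivalently, for all polynomials $f$). Let $H_{ac}$ (resp. $H_{sc}$) be the subspace of all $\psi$ for which $\mu_\psi$ is absolutely continuous with respect to Lebesgue measure (resp. atomless and singular to Lebesgue measure), put $H_{cont}=H_{ac}\oplus H_{sc}$, and let $\sigma_{cont}(A)$ be the spectrum of the restriction $A|_{H_{cont}}$. Let $\sigma_p(A)$ be the set of eigenvalues of $A$; the multiplicity of $\lambda\in\sigma_p(A)$ is $\dim\operatorname{Ker}(A-\lambda)$.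 Then $E$ is LEC-plastic if and only if the following two conditions hold: 1. $\sigma_{cont}(A)=\emptyset$; 2. every subset of $\sigma_p(A)$ with more than one element has either a maximum of finite multiplicity or a minimum of finite multiplicity (possibly both). -/

import Mathlib

open MeasureTheory Polynomial

noncomputable section

/-- A subset `M` of a normed space `X` over `𝕜` is linearly expand-contract plastic if every
linear operator `T : X → X` whose restriction to `M` is a non-expansive bijection of `M` onto `M`
is an isometry on `M`. -/
def IsLECPlastic (𝕜 : Type*) {X : Type*} [RCLike 𝕜] [NormedAddCommGroup X] [NormedSpace 𝕜 X]
    (M : Set X) : Prop :=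
  ∀ T : X →ₗ[𝕜] X, Set.BijOn T M M →
    (∀ x ∈ M, ∀ y ∈ M, dist (T x) (T y) ≤ dist x y) →
    ∀ x ∈ M, ∀ y ∈ M, dist (T x) (T y) = dist x y

section Operators

variable {𝕜 H : Type*} [RCLike 𝕜] [NormedAddCommGroup H] [InnerProductSpace 𝕜 H]

/-- The ellipsoid `{x | ⟨x, A x⟩ ≤ 1}` generated by `A` (for self-adjoint `A` the number
`⟨x, A x⟩` is real, so taking the real part changes nothing). -/
def ellipsoid (A : H →L[𝕜] H) : Set H :=
  {x | RCLike.re (inner 𝕜 x (A x)) ≤ 1}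

/-- The real numbers that lie in the spectrum of `A`. For self-adjoint `A` on a Hilbert space
this is the whole spectrum. -/
def realSpectrum (A : H →L[𝕜] H) : Set ℝ :=
  {t | (t : 𝕜) ∈ spectrum 𝕜 A}

/-- The eigenspace `Ker (A - t)`. -/
def realEigenspace (A : H →L[𝕜] H) (t : ℝ) : Submodule 𝕜 H :=
  Module.End.eigenspace (A : H →ₗ[𝕜] H) (t : 𝕜)

/-- The set of all (real) eigenvalues of `A`; the eigenvalues of a self-adjoint operator
are real. -/
def pointSpectrum (A : H →L[𝕜] H) : Set ℝ :=
  {t | Module.End.HasEigenvalue (A : H →ₗ[𝕜] H) (t : 𝕜)}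

/-- The eigenvalue `t` of `A` has finite multiplicity. -/
def HasFiniteMultiplicity (A : H →L[𝕜] H) (t : ℝ) : Prop :=
  FiniteDimensional 𝕜 (realEigenspace A t)

/-- `μ` is the spectral measure of the self-adjoint operator `A` associated with the vector `ψ`:
the finite Borel measure carried by the spectrum of `A` with `⟨ψ, f(A) ψ⟩ = ∫ f dμ`. It is enough
to let `f` run through the polynomials, since they are dense in `C(σ(A))` and `f ↦ f(A)` is
continuous; for the same reason `μ` is unique. -/
structure IsSpectralMeasure (A : H →L[𝕜] H) (ψ : H) (μ : Measure ℝ) : Prop where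
  isFinite : IsFiniteMeasure μ
  carried : μ (realSpectrum A)ᶜ = 0
  inner_eq : ∀ p : 𝕜[X], inner 𝕜 ψ (aeval A p ψ) = ∫ t : ℝ, p.eval (t : 𝕜) ∂μ

/-- A Borel measure on the line is singularly continuous if it is singular with respect to
Lebesgue measure and has no atoms. -/
def IsSingularContinuous (μ : Measure ℝ) : Prop :=
  μ.MutuallySingular volume ∧ ∀ t : ℝ, μ {t} = 0

/-- The subspace `H_ac` of all vectors whose spectral measure is absolutely continuous. These
vectors form a linear subspace when `A` is self-adjoint, so that taking the span adds nothing. -/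
def acSubspace (A : H →L[𝕜] H) : Submodule 𝕜 H :=
  Submodule.span 𝕜 {ψ | ∃ μ, IsSpectralMeasure A ψ μ ∧ μ.AbsolutelyContinuous volume}

/-- The subspace `H_sc` of all vectors whose spectral measure is singularly continuous. These
vectors form a linear subspace when `A` is self-adjoint, so that taking the span adds nothing. -/
def scSubspace (A : H →L[𝕜] H) : Submodule 𝕜 H :=
  Submodule.span 𝕜 {ψ | ∃ μ, IsSpectralMeasure A ψ μ ∧ IsSingularContinuous μ}

/-- The subspace `H_cont = H_ac ⊕ H_sc`. -/
def contSubspace (A : H →L[𝕜] H) : Submodule 𝕜 H :=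
  acSubspace A ⊔ scSubspace A

variable [CompleteSpace H]

/-- If `μ` is the spectral measure of `ψ`, then `t ^ 2 dμ(t)` is the spectral measure of `A ψ`. -/
theorem IsSpectralMeasure.map_vector {A : H →L[𝕜] H} (hA : IsSelfAdjoint A) {ψ : H}
    {μ : Measure ℝ} (h : IsSpectralMeasure A ψ μ) :
    IsSpectralMeasure A (A ψ) (μ.withDensity fun t => ((‖t‖₊ ^ 2 : NNReal) : ENNReal)) := by
  have hfin := h.isFinite
  refine ⟨?_, withDensity_absolutelyContinuous _ _ h.carried, fun p => ?_⟩
  · refine isFiniteMeasure_withDensity (ne_of_lt ?_)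
    set C : NNReal := (‖A‖₊ * ‖(1 : H →L[𝕜] H)‖₊) ^ 2
    have hC : ∀ᵐ t ∂μ, ((‖t‖₊ ^ 2 : NNReal) : ENNReal) ≤ (C : ENNReal) := by
      have h0 : ∀ᵐ t ∂μ, t ∈ realSpectrum A := h.carried
      filter_upwards [h0] with t ht
      have h1 := spectrum.norm_le_norm_mul_of_mem ht
      rw [RCLike.norm_ofReal] at h1
      refine ENNReal.coe_le_coe.2 (pow_le_pow_left₀ (by positivity) ?_ 2)
      exact h1
    calc ∫⁻ t, ((‖t‖₊ ^ 2 : NNReal) : ENNReal) ∂μ ≤ ∫⁻ _, (C : ENNReal) ∂μ := lintegral_mono_ae hC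
      _ < ⊤ := by
        rw [lintegral_const]
        exact ENNReal.mul_lt_top ENNReal.coe_lt_top (measure_lt_top μ _)
  · rw [integral_withDensity_eq_integral_smul (by fun_prop)]
    have hsym : inner 𝕜 (A ψ) (aeval A p (A ψ)) = inner 𝕜 ψ (aeval A (X * p * X) ψ) := by
      simp only [map_mul, aeval_X, mul_apply_eq_comp]
      exact hA.isSymmetric ψ _
    rw [hsym, h.inner_eq]
    congr 1
    ext t
    simp only [eval_mul, eval_X, NNReal.smul_def, RCLike.real_smul_eq_coe_mul]
    have : (((‖t‖₊ ^ 2 : NNReal) : ℝ) : 𝕜) = (t : 𝕜) * t := by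
      rw [← RCLike.ofReal_mul]
      congr 1
      simp [sq]
    rw [this]
    ring

/-- The subspace `H_cont` of a self-adjoint operator is invariant. -/
theorem contSubspace_invariant {A : H →L[𝕜] H} (hA : IsSelfAdjoint A) :
    ∀ x ∈ contSubspace A, A x ∈ contSubspace A := by
  have hac : acSubspace A ≤ (acSubspace A).comap (A : H →ₗ[𝕜] H) := by
    refine Submodule.span_le.2 ?_
    rintro ψ ⟨μ, hμ, hac⟩
    exact Submodule.subset_span ⟨_, hμ.map_vector hA,
      (withDensity_absolutelyContinuous _ _).trans hac⟩
  have hsc : scSubspace A ≤ (scSubspace A).comap (A : H →ₗ[𝕜] H) := by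
    refine Submodule.span_le.2 ?_
    rintro ψ ⟨μ, hμ, hs, ha⟩
    exact Submodule.subset_span ⟨_, hμ.map_vector hA,
      hs.mono_ac (withDensity_absolutelyContinuous _ _) Measure.AbsolutelyContinuous.rfl,
      fun t => withDensity_absolutelyContinuous _ _ (ha t)⟩
  have : contSubspace A ≤ (contSubspace A).comap (A : H →ₗ[𝕜] H) :=
    sup_le (hac.trans (Submodule.comap_mono le_sup_left))
      (hsc.trans (Submodule.comap_mono le_sup_right))
  exact this

/-- The continuous spectrum `σ_cont(A)`: the spectrum of the restriction of `A` to the invariant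
subspace `H_cont`. -/
def contSpectrum (A : H →L[𝕜] H) (hA : IsSelfAdjoint A) : Set 𝕜 :=
  spectrum 𝕜 (A.restrict (contSubspace_invariant hA))

end Operators

end

/-! An operator `T` as in the definition of plasticity is a bijective contraction of `H` that
preserves the form `⟨Ax, y⟩` (`exists_equiv_of_bijOn_ellipsoid`). Conversely, for every unitary `U`
the operator `A^(-1/2) U A^(1/2)` is a bijection of `E`, and it is a contraction exactly when
`‖A^(-1/2) U x‖ ≤ ‖A^(-1/2) x‖` for all `x`.

Sufficiency (`norm_eq_of_form_preserving`). If `H_cont = 0`, the eigenvectors are total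
(`eq_zero_of_contSubspace_eq_bot`). Let `B` be the set of eigenvalues whose eigenspace is not mapped
onto itself by `T`; the orthogonal complement `L` of the other eigenspaces is `T`-invariant. If `m =
max B`, then `m - A ≥ 0` on `L`, and for `x ∈ Ker (A - m)` one gets `⟨(m - A)Tx, Tx⟩ ≤ ⟨(m - A)x, x⟩
= 0`, so `Tx ∈ Ker (A - m)`. At a minimum of `B` the same works for the inverse of `T`. Finite
multiplicity turns the inclusion into an equality, a contradiction; if `B` is a singleton, both
inclusions hold. Hence `B = ∅`, and preservation of the form makes `T` isometric on each eigenspace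
and, by totality, everywhere.

Necessity. A set `B` violating the extremum condition supplies a nondecreasing, nonconstant
bilateral sequence of eigenvalues with orthonormal eigenvectors, since an infinite multiplicity at
an end permits repetition. If `H_cont ≠ 0`, separated intervals carry infinite-dimensional spectral
subspaces, all isometric to `ℓ²` by separability. In both cases the bilateral shift to the right is
a unitary that never increases `‖A^(-1/2) x‖` and somewhere decreases it
(`not_isLECPlastic_of_shift`).

The spectral theory rests on `exists_norm_aeval_eq`, which yields the continuous calculus, and on
the vectors `χ_K(A) ψ` of `RepresentsVector.exists_restrict`. -/

noncomputable section

open MeasureTheory Polynomial Filter Topology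

/-! ### The norm of a symmetric operator and its spectrum. -/

section SpectralRadius

variable {𝕜 V : Type*} [RCLike 𝕜] [NormedAddCommGroup V] [InnerProductSpace 𝕜 V]

/-- Expand the square and use `‖S(Sx)‖ ≤ ‖S‖ ‖Sx‖`. Vectors that almost attain the norm of `S` are
thus approximate eigenvectors of `S²` at `‖S‖²`. -/
theorem norm_sq_sub_sq_smul_le (S : V →L[𝕜] V) (hS : ∀ x y, inner 𝕜 (S x) y = inner 𝕜 x (S y))
    (x : V) : ‖S (S x) - ((‖S‖ ^ 2 : ℝ) : 𝕜) • x‖ ^ 2 ≤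
      2 * ‖S‖ ^ 2 * (‖S‖ ^ 2 * ‖x‖ ^ 2 - ‖S x‖ ^ 2) := by
  have h1 : ‖S (S x)‖ ≤ ‖S‖ * ‖S x‖ := S.le_opNorm _
  have h2 : ‖S x‖ ≤ ‖S‖ * ‖x‖ := S.le_opNorm _
  have h3 : RCLike.re (inner 𝕜 (S (S x)) (((‖S‖ ^ 2 : ℝ) : 𝕜) • x)) = ‖S‖ ^ 2 * ‖S x‖ ^ 2 := by
    rw [inner_smul_right, hS, RCLike.re_ofReal_mul, inner_self_eq_norm_sq]
  rw [@norm_sub_sq 𝕜, h3, norm_smul, RCLike.norm_ofReal, abs_of_nonneg (by positivity)]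
  have h4 : ‖S (S x)‖ ^ 2 ≤ ‖S‖ ^ 2 * ‖S x‖ ^ 2 := by
    rw [← mul_pow]; gcongr
  have h5 : ‖S x‖ ^ 2 ≤ ‖S‖ ^ 2 * ‖x‖ ^ 2 := by
    rw [← mul_pow]; gcongr
  nlinarith [mul_le_mul_of_nonneg_left h5 (sq_nonneg ‖S‖)]

/-- A symmetric operator attains its norm, up to sign, in its spectrum. The space need not be
complete. -/
theorem exists_mem_spectrum_abs_eq_norm [Nontrivial V] (S : V →L[𝕜] V)
    (hS : ∀ x y, inner 𝕜 (S x) y = inner 𝕜 x (S y)) :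
    ∃ t : ℝ, |t| = ‖S‖ ∧ (t : 𝕜) ∈ spectrum 𝕜 S := by
  by_contra! hcon
  have hu1 := hcon ‖S‖ (abs_of_nonneg (norm_nonneg _))
  have hu2 := hcon (-‖S‖) (by rw [abs_neg, abs_of_nonneg (norm_nonneg _)])
  rw [spectrum.notMem_iff] at hu1 hu2
  -- The product of the two units is `S² - ‖S‖²`.
  obtain ⟨W, hW⟩ := hu1.mul hu2
  have hWx : ∀ x, (W : V →L[𝕜] V) x = S (S x) - ((‖S‖ ^ 2 : ℝ) : 𝕜) • x := by
    intro x
    have ha : ∀ (a : 𝕜) (y : V), algebraMap 𝕜 (V →L[𝕜] V) a y = a • y := fun _ _ => rfl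
    simp only [hW, mul_apply_eq_comp, sub_apply, ha, map_sub, map_smul, RCLike.ofReal_neg, sq]
    module
  set C := ‖((W⁻¹ : (V →L[𝕜] V)ˣ) : V →L[𝕜] V)‖ with hC
  set M := ‖S‖ with hM
  have hM0 : 0 ≤ M := norm_nonneg _
  have hbd : ∀ x, ‖x‖ ^ 2 ≤ (2 * C ^ 2 * M ^ 2) * (M ^ 2 * ‖x‖ ^ 2 - ‖S x‖ ^ 2) := by
    intro x
    have h1 : ‖x‖ ≤ C * ‖(W : V →L[𝕜] V) x‖ := by
      have : ((W⁻¹ : (V →L[𝕜] V)ˣ) : V →L[𝕜] V) ((W : V →L[𝕜] V) x) = x := by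
        rw [← mul_apply_eq_comp, Units.inv_mul]; rfl
      calc ‖x‖ = ‖((W⁻¹ : (V →L[𝕜] V)ˣ) : V →L[𝕜] V) ((W : V →L[𝕜] V) x)‖ := by rw [this]
        _ ≤ _ := ContinuousLinearMap.le_opNorm _ _
    have h2 := norm_sq_sub_sq_smul_le S hS x
    rw [← hWx] at h2
    calc ‖x‖ ^ 2 ≤ (C * ‖(W : V →L[𝕜] V) x‖) ^ 2 := by gcongr
      _ = C ^ 2 * ‖(W : V →L[𝕜] V) x‖ ^ 2 := by ring
      _ ≤ C ^ 2 * (2 * M ^ 2 * (M ^ 2 * ‖x‖ ^ 2 - ‖S x‖ ^ 2)) := by gcongr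
      _ = _ := by ring
  set k := 2 * C ^ 2 * M ^ 2 with hk
  have hk0 : 0 ≤ k := by positivity
  obtain ⟨x, hx⟩ := exists_ne (0 : V)
  have hx' : 0 < ‖x‖ := norm_pos_iff.2 hx
  have hkM : 1 ≤ k * M ^ 2 := by
    have h1 := hbd x
    have h2 : 0 ≤ k * ‖S x‖ ^ 2 := by positivity
    have h3 : 0 < ‖x‖ ^ 2 := by positivity
    by_contra! h
    nlinarith
  have hkpos : 0 < k := by
    rcases hk0.lt_or_eq with h | h
    · exact h
    · rw [← h] at hkM; linarith
  -- Bounded invertibility of `W` keeps `‖Sx‖` uniformly away from `M ‖x‖`, which gives an operator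
  -- bound below the norm.
  have hle : M ≤ √(M ^ 2 - 1 / k) := by
    refine S.opNorm_le_bound (Real.sqrt_nonneg _) fun y => ?_
    refine le_of_sq_le_sq ?_ (by positivity)
    have h0 : 0 ≤ M ^ 2 - 1 / k := by
      rw [sub_nonneg, div_le_iff₀ hkpos]; linarith
    rw [mul_pow, Real.sq_sqrt h0]
    have h1 := hbd y
    have h2 : 1 / k * ‖y‖ ^ 2 ≤ M ^ 2 * ‖y‖ ^ 2 - ‖S y‖ ^ 2 := by
      rw [one_div, inv_mul_le_iff₀ hkpos]; exact h1
    linarith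
  have h0 : 0 ≤ M ^ 2 - 1 / k := by
    rw [sub_nonneg, div_le_iff₀ hkpos]; linarith
  have h1 : M ^ 2 ≤ M ^ 2 - 1 / k := by
    calc M ^ 2 ≤ √(M ^ 2 - 1 / k) ^ 2 := by gcongr
      _ = _ := Real.sq_sqrt h0
  have : 0 < 1 / k := by positivity
  linarith

end SpectralRadius

/-! ### Real polynomials of a self-adjoint operator. -/

section RealPolynomials

variable {𝕜 H : Type*} [RCLike 𝕜] [NormedAddCommGroup H] [InnerProductSpace 𝕜 H]

/-- Real scalars act on operators over either field, so one calculus with real functions serves both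
cases. -/
instance ContinuousLinearMap.realNormedSpace : NormedSpace ℝ (H →L[𝕜] H) :=
  NormedSpace.restrictScalars ℝ 𝕜 (H →L[𝕜] H)

instance ContinuousLinearMap.realNormedAlgebra : NormedAlgebra ℝ (H →L[𝕜] H) :=
  NormedAlgebra.restrictScalars ℝ 𝕜 (H →L[𝕜] H)

theorem real_smul_clm_apply (r : ℝ) (S : H →L[𝕜] H) (x : H) : (r • S) x = (r : 𝕜) • S x := rfl

theorem algebraMap_real_clm (r : ℝ) :
    algebraMap ℝ (H →L[𝕜] H) r = algebraMap 𝕜 (H →L[𝕜] H) (r : 𝕜) := rfl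

theorem algebraMap_real_clm_apply (r : ℝ) (x : H) :
    algebraMap ℝ (H →L[𝕜] H) r x = (r : 𝕜) • x := rfl

theorem realSpectrum_eq_spectrum (A : H →L[𝕜] H) : realSpectrum A = spectrum ℝ A := by
  ext t
  rw [realSpectrum, Set.mem_ofPred_eq, spectrum.mem_iff, spectrum.mem_iff, algebraMap_real_clm]

theorem aeval_map_ofReal (A : H →L[𝕜] H) (p : ℝ[X]) :
    aeval A (p.map (algebraMap ℝ 𝕜)) = aeval A p := by
  induction p using Polynomial.induction_on' with
  | add p q hp hq => simp [hp, hq]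
  | monomial n a =>
    rw [Polynomial.map_monomial, aeval_monomial, aeval_monomial, algebraMap_real_clm]

theorem aeval_apply_of_eigen {A : H →L[𝕜] H} {x : H} {t : ℝ} (hx : A x = (t : 𝕜) • x) (p : ℝ[X]) :
    aeval A p x = ((p.eval t : ℝ) : 𝕜) • x := by
  induction p using Polynomial.induction_on with
  | C a => rw [aeval_C, eval_C]; rfl
  | add p q hp hq => rw [map_add, add_apply, hp, hq, eval_add, RCLike.ofReal_add, add_smul]
  | monomial n a h =>
    rw [pow_succ, ← mul_assoc, map_mul, mul_apply_eq_comp, aeval_X, hx, map_smul, h, eval_mul (p := C a * X ^ n),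
      eval_X, smul_smul, RCLike.ofReal_mul, mul_comm]

theorem mem_realSpectrum_of_eigen {A : H →L[𝕜] H} {x : H} (hx0 : x ≠ 0) {t : ℝ} (hx : A x = (t : 𝕜) • x) :
    t ∈ realSpectrum A := by
  intro ⟨u, hu⟩
  refine hx0 ?_
  have h1 : (u : H →L[𝕜] H) x = 0 := by
    rw [hu, sub_apply, hx]; exact sub_self _
  calc x = (((u⁻¹ : (H →L[𝕜] H)ˣ) : H →L[𝕜] H) * (u : H →L[𝕜] H)) x := by
        rw [Units.inv_mul]; rfl
    _ = 0 := by rw [mul_apply_eq_comp, h1, map_zero]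

/-- Restriction of real polynomials to the spectrum. -/
def polyOnSpectrum (A : H →L[𝕜] H) : ℝ[X] →ₐ[ℝ] C(realSpectrum A, ℝ) :=
  toContinuousMapOnAlgHom (realSpectrum A)

theorem polyOnSpectrum_apply (A : H →L[𝕜] H) (p : ℝ[X]) (t : realSpectrum A) :
    polyOnSpectrum A p t = p.eval (t : ℝ) := rfl

variable [CompleteSpace H]

theorem isSelfAdjoint_real_smul (r : ℝ) {S : H →L[𝕜] H} (hS : IsSelfAdjoint S) :
    IsSelfAdjoint (r • S) := by
  have : r • S = (r : 𝕜) • S := rfl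
  rw [this, IsSelfAdjoint, star_smul, hS.star_eq]
  simp

theorem isSelfAdjoint_aeval {A : H →L[𝕜] H} (hA : IsSelfAdjoint A) (p : ℝ[X]) :
    IsSelfAdjoint (aeval A p) := by
  induction p using Polynomial.induction_on' with
  | add p q hp hq => rw [map_add]; exact hp.add hq
  | monomial n a =>
    rw [aeval_monomial, ← Algebra.smul_def]
    exact isSelfAdjoint_real_smul a (hA.pow n)

theorem isUnit_sq_add {S : H →L[𝕜] H} (hS : IsSelfAdjoint S) {d : ℝ} (hd : 0 < d) :
    IsUnit (S ^ 2 + algebraMap ℝ (H →L[𝕜] H) d) := by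
  lift d to NNReal using hd.le
  refine ContinuousLinearMap.isUnit_of_forall_le_norm_inner_map _ (NNReal.coe_pos.1 hd)
    fun x => ?_
  refine le_trans ?_ (RCLike.re_le_norm _)
  have h1 : (S ^ 2) x = S (S x) := by rw [sq, mul_apply_eq_comp]
  rw [add_apply, inner_add_left, map_add, h1,
    algebraMap_real_clm_apply, inner_smul_left, RCLike.conj_ofReal, RCLike.re_ofReal_mul,
    inner_self_eq_norm_sq]
  have h2 : inner 𝕜 (S (S x)) x = inner 𝕜 (S x) (S x) := hS.isSymmetric (S x) x
  rw [h2, inner_self_eq_norm_sq]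
  have : 0 ≤ ‖S x‖ ^ 2 := by positivity
  nlinarith

/-- An irreducible real polynomial is linear or a nonzero multiple of a square plus a positive
constant; in the second case `isUnit_sq_add` applies. This stays valid over `ℝ`, where complex roots
cannot be used. -/
theorem isUnit_aeval_of_degree_le_two {A : H →L[𝕜] H} (hA : IsSelfAdjoint A) {q : ℝ[X]}
    (hq : Irreducible q) (hroot : ∀ t ∈ realSpectrum A, q.eval t ≠ 0) : IsUnit (aeval A q) := by
  by_cases hex : ∃ t, q.IsRoot t
  · obtain ⟨t, ht⟩ := hex
    obtain ⟨u, hu⟩ := (irreducible_X_sub_C t).associated_of_dvd hq (dvd_iff_isRoot.2 ht)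
    rw [← hu, map_mul]
    refine IsUnit.mul ?_ (u.isUnit.map _)
    have htσ : t ∉ realSpectrum A := fun h => hroot t h ht
    rw [realSpectrum_eq_spectrum, spectrum.notMem_iff] at htσ
    rw [map_sub, aeval_X, aeval_C, ← neg_sub]
    exact htσ.neg
  · push Not at hex
    obtain ⟨a, b, c, rfl⟩ : ∃ a b c : ℝ, q = C a * X ^ 2 + C b * X + C c :=
      ⟨_, _, _, eq_quadratic_of_degree_le_two hq.degree_le_two⟩
    have hev : ∀ t, a * t ^ 2 + b * t + c ≠ 0 := fun t h => hex t (by simpa using h)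
    have ha : a ≠ 0 := by
      rintro rfl
      have hb : b = 0 := by
        by_contra hb
        exact hev (-c / b) (by field_simp; ring)
      subst hb
      have hc : c ≠ 0 := by simpa using hev 0
      exact hq.not_isUnit (by simpa using hc)
    have hd : 0 < c / a - (b / (2 * a)) ^ 2 := by
      by_contra! hd
      refine hev (-(b / (2 * a)) + √((b / (2 * a)) ^ 2 - c / a)) ?_
      have h1 : √((b / (2 * a)) ^ 2 - c / a) ^ 2 = (b / (2 * a)) ^ 2 - c / a :=
        Real.sq_sqrt (by linarith)
      generalize √((b / (2 * a)) ^ 2 - c / a) = s at h1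
      have h2 : a * (-(b / (2 * a)) + s) ^ 2 + b * (-(b / (2 * a)) + s) + c =
          a * (s ^ 2 - ((b / (2 * a)) ^ 2 - c / a)) := by field_simp; ring
      rw [h2, h1, sub_self, mul_zero]
    have hq' : C a * X ^ 2 + C b * X + C c =
        C a * ((X + C (b / (2 * a))) ^ 2 + C (c / a - (b / (2 * a)) ^ 2)) := by
      have h1 : C b = C a * (2 * C (b / (2 * a))) := by
        rw [← C_ofNat, ← C_mul, ← C_mul]; congr 1; field_simp
      have h2 : C c = C a * C (c / a) := by
        rw [← C_mul]; congr 1; field_simp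
      rw [h1, h2, C_sub, C_pow]
      ring
    rw [hq', map_mul, map_add, map_pow]
    refine IsUnit.mul ?_ ?_
    · rw [aeval_C]
      exact (IsUnit.mk0 a ha).map _
    · rw [aeval_C]
      exact isUnit_sq_add (isSelfAdjoint_aeval hA _) hd

theorem isUnit_aeval {A : H →L[𝕜] H} (hA : IsSelfAdjoint A) (q : ℝ[X]) (hq0 : q ≠ 0)
    (hroot : ∀ t ∈ realSpectrum A, q.eval t ≠ 0) : IsUnit (aeval A q) := by
  induction q using WfDvdMonoid.induction_on_irreducible with
  | zero => exact absurd rfl hq0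
  | unit u hu => exact hu.map (aeval A)
  | mul a i ha hi ih =>
    simp only [eval_mul, ne_eq, mul_eq_zero, not_or] at hroot
    rw [map_mul]
    exact (isUnit_aeval_of_degree_le_two hA hi fun t ht => (hroot t ht).1).mul
      (ih ha fun t ht => (hroot t ht).2)

theorem nonempty_realSpectrum [Nontrivial H] {A : H →L[𝕜] H} (hA : IsSelfAdjoint A) :
    (realSpectrum A).Nonempty := by
  obtain ⟨t, -, ht⟩ := exists_mem_spectrum_abs_eq_norm A hA.isSymmetric
  exact ⟨t, ht⟩

/-- Choose `s` in the spectrum of `p(A)` with `|s| = ‖p(A)‖`. Then `(s - p)(A)` is not invertible,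
so by `isUnit_aeval` the polynomial `s - p` vanishes somewhere on the spectrum, or identically. -/
theorem exists_norm_aeval_eq [Nontrivial H] {A : H →L[𝕜] H} (hA : IsSelfAdjoint A) (p : ℝ[X]) :
    ∃ t ∈ realSpectrum A, ‖aeval A p‖ = |p.eval t| := by
  obtain ⟨s, hs, hsp⟩ := exists_mem_spectrum_abs_eq_norm (aeval A p)
    (isSelfAdjoint_aeval hA p).isSymmetric
  rw [spectrum.mem_iff, ← algebraMap_real_clm] at hsp
  have hsub : algebraMap ℝ (H →L[𝕜] H) s - aeval A p = aeval A (C s - p) := by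
    rw [map_sub, aeval_C]
  rw [hsub] at hsp
  by_cases h0 : C s - p = 0
  · obtain ⟨t, ht⟩ := nonempty_realSpectrum hA
    refine ⟨t, ht, ?_⟩
    rw [← hs, ← sub_eq_zero.1 h0, eval_C]
  · by_contra! hcon
    refine hsp (isUnit_aeval hA _ h0 fun t ht h => hcon t ht ?_)
    rw [eval_sub, eval_C, sub_eq_zero] at h
    rw [← h, hs]

theorem isCompact_realSpectrum (A : H →L[𝕜] H) : IsCompact (realSpectrum A) := by
  rw [realSpectrum_eq_spectrum]
  exact spectrum.isCompact A

end RealPolynomials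

/-! ### The continuous functional calculus. -/

section ContinuousCalculus

variable {𝕜 H : Type*} [RCLike 𝕜] [NormedAddCommGroup H] [InnerProductSpace 𝕜 H] [CompleteSpace H]

instance compactSpace_realSpectrum (A : H →L[𝕜] H) : CompactSpace (realSpectrum A) :=
  isCompact_iff_compactSpace.1 (isCompact_realSpectrum A)

theorem denseRange_polyOnSpectrum (A : H →L[𝕜] H) :
    DenseRange (polyOnSpectrum A).toLinearMap := by
  have h := polynomialFunctions.topologicalClosure (realSpectrum A)
  intro f
  have hf : f ∈ (polynomialFunctions (realSpectrum A)).topologicalClosure := by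
    rw [h]; trivial
  rw [← SetLike.mem_coe, Subalgebra.topologicalClosure_coe, polynomialFunctions_coe] at hf
  exact hf

/-- The continuous functional calculus `f ↦ f(A)` for real functions on the spectrum. -/
def contCalc (A : H →L[𝕜] H) : C(realSpectrum A, ℝ) →L[ℝ] (H →L[𝕜] H) :=
  (aeval A : ℝ[X] →ₐ[ℝ] (H →L[𝕜] H)).toLinearMap.extendOfNorm (polyOnSpectrum A).toLinearMap

theorem contCalc_induction (A : H →L[𝕜] H) {P : C(realSpectrum A, ℝ) → Prop}
    (hP : IsClosed {f | P f}) (h : ∀ p, P (polyOnSpectrum A p)) (f) : P f :=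
  (denseRange_polyOnSpectrum A).induction_on f hP h

variable [Nontrivial H] {A : H →L[𝕜] H}

/-- The bound `‖p(A)‖ ≤ ‖p‖` in the sup norm on the spectrum is what the extension by density
requires. -/
theorem contCalc_poly (hA : IsSelfAdjoint A) (p : ℝ[X]) : contCalc A (polyOnSpectrum A p) = aeval A p := by
  refine LinearMap.extendOfNorm_eq (denseRange_polyOnSpectrum A) ⟨1, fun p => ?_⟩ p
  obtain ⟨t, ht, h⟩ := exists_norm_aeval_eq hA p
  rw [one_mul, AlgHom.toLinearMap_apply, h]
  exact (polyOnSpectrum A p).norm_coe_le_norm ⟨t, ht⟩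

theorem contCalc_one (hA : IsSelfAdjoint A) : contCalc A 1 = 1 := by
  rw [← map_one (polyOnSpectrum A), contCalc_poly hA, map_one]

theorem contCalc_X (hA : IsSelfAdjoint A) : contCalc A (polyOnSpectrum A X) = A := by
  rw [contCalc_poly hA, aeval_X]

theorem contCalc_mul (hA : IsSelfAdjoint A) (f g : C(realSpectrum A, ℝ)) :
    contCalc A (f * g) = contCalc A f * contCalc A g := by
  induction f using contCalc_induction with
  | hP => exact isClosed_eq (by fun_prop) (by fun_prop)
  | h p =>
    induction g using contCalc_induction with
    | hP => exact isClosed_eq (by fun_prop) (by fun_prop)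
    | h q => rw [← map_mul, contCalc_poly hA, contCalc_poly hA, contCalc_poly hA, map_mul]

theorem contCalc_mul_apply (hA : IsSelfAdjoint A) (f g : C(realSpectrum A, ℝ)) (x : H) :
    contCalc A (f * g) x = contCalc A f (contCalc A g x) := by
  rw [contCalc_mul hA]; rfl

theorem contCalc_comm_apply (hA : IsSelfAdjoint A) (f g : C(realSpectrum A, ℝ)) (x : H) :
    contCalc A f (contCalc A g x) = contCalc A g (contCalc A f x) := by
  rw [← contCalc_mul_apply hA, mul_comm, contCalc_mul_apply hA]

theorem isSelfAdjoint_contCalc (hA : IsSelfAdjoint A) (f : C(realSpectrum A, ℝ)) : IsSelfAdjoint (contCalc A f) := by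
  induction f using contCalc_induction with
  | hP => exact isClosed_eq (by fun_prop) (by fun_prop)
  | h p => rw [contCalc_poly hA]; exact isSelfAdjoint_aeval hA p

theorem inner_contCalc_left (hA : IsSelfAdjoint A) (f : C(realSpectrum A, ℝ)) (x y : H) :
    inner 𝕜 (contCalc A f x) y = inner 𝕜 x (contCalc A f y) :=
  (isSelfAdjoint_contCalc hA f).isSymmetric x y

theorem norm_contCalc_apply_sq (hA : IsSelfAdjoint A) (f : C(realSpectrum A, ℝ)) (x : H) :
    ‖contCalc A f x‖ ^ 2 = RCLike.re (inner 𝕜 x (contCalc A (f * f) x)) := by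
  rw [contCalc_mul_apply hA, ← inner_contCalc_left hA, inner_self_eq_norm_sq]

theorem re_inner_contCalc_nonneg (hA : IsSelfAdjoint A) {f : C(realSpectrum A, ℝ)} (hf : ∀ t, 0 ≤ f t) (x : H) :
    0 ≤ RCLike.re (inner 𝕜 x (contCalc A f x)) := by
  let g : C(realSpectrum A, ℝ) := ⟨fun t => √(f t), by fun_prop⟩
  have hg : f = g * g := by
    ext t
    exact (Real.mul_self_sqrt (hf t)).symm
  rw [hg, ← norm_contCalc_apply_sq hA]
  positivity

theorem re_inner_contCalc_mono (hA : IsSelfAdjoint A) {f g : C(realSpectrum A, ℝ)} (hfg : ∀ t, f t ≤ g t) (x : H) :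
    RCLike.re (inner 𝕜 x (contCalc A f x)) ≤ RCLike.re (inner 𝕜 x (contCalc A g x)) := by
  have h := re_inner_contCalc_nonneg hA (f := g - f) (fun t => sub_nonneg.2 (hfg t)) x
  rw [map_sub, sub_apply, inner_sub_right, map_sub] at h
  linarith

theorem im_inner_contCalc (hA : IsSelfAdjoint A) (f : C(realSpectrum A, ℝ)) (x : H) :
    RCLike.im (inner 𝕜 x (contCalc A f x)) = 0 := by
  have h := (isSelfAdjoint_contCalc hA f).isSymmetric.im_inner_self_apply x
  rwa [ContinuousLinearMap.coe_coe] at h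

theorem inner_contCalc_self (hA : IsSelfAdjoint A) (f : C(realSpectrum A, ℝ)) (x : H) :
    inner 𝕜 x (contCalc A f x) = (RCLike.re (inner 𝕜 x (contCalc A f x)) : 𝕜) := by
  apply RCLike.ext
  · simp
  · rw [im_inner_contCalc hA]; simp

theorem contCalc_apply_of_eigen (hA : IsSelfAdjoint A) {x : H} {t : realSpectrum A} (hx : A x = ((t : ℝ) : 𝕜) • x)
    (f : C(realSpectrum A, ℝ)) : contCalc A f x = ((f t : ℝ) : 𝕜) • x := by
  induction f using contCalc_induction with
  | hP =>
    refine isClosed_eq (by fun_prop) ?_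
    exact (RCLike.continuous_ofReal.comp (continuous_eval_const t)).smul
      continuous_const
  | h p => rw [contCalc_poly hA, aeval_apply_of_eigen hx, polyOnSpectrum_apply]

end ContinuousCalculus

/-! ### Spectral measures as measures on the compact spectrum. -/

section SpectralMeasures

variable {𝕜 H : Type*} [RCLike 𝕜] [NormedAddCommGroup H] [InnerProductSpace 𝕜 H] [CompleteSpace H]

/-- The finite measure `ν` on the spectrum represents the functional `f ↦ ⟨ψ, f(A) ψ⟩`. -/
structure RepresentsVector (A : H →L[𝕜] H) (ψ : H) (ν : Measure (realSpectrum A)) : Prop where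
  isFinite : IsFiniteMeasure ν
  re_inner_eq : ∀ f : C(realSpectrum A, ℝ),
    RCLike.re (inner 𝕜 ψ (contCalc A f ψ)) = ∫ t, f t ∂ν

theorem integrable_continuousMap {A : H →L[𝕜] H} (ν : Measure (realSpectrum A)) [IsFiniteMeasure ν]
    (f : C(realSpectrum A, ℝ)) : Integrable f ν :=
  f.continuous.integrable_of_hasCompactSupport (HasCompactSupport.of_compactSpace _)

variable [Nontrivial H] {A : H →L[𝕜] H}

/-- Riesz–Markov for the positive functional `f ↦ Re ⟨ψ, f(A) ψ⟩`; on a compact space every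
continuous function has compact support. -/
theorem exists_representsVector (hA : IsSelfAdjoint A) (ψ : H) :
    ∃ ν, RepresentsVector A ψ ν := by
  let L : CompactlySupportedContinuousMap (realSpectrum A) ℝ →ₗ[ℝ] ℝ :=
    { toFun := fun f => RCLike.re (inner 𝕜 ψ (contCalc A f.toContinuousMap ψ))
      map_add' := fun f g => by
        have : (f + g).toContinuousMap = f.toContinuousMap + g.toContinuousMap := rfl
        rw [this, map_add, add_apply, inner_add_right, map_add]
      map_smul' := fun r f => by
        have : (r • f).toContinuousMap = r • f.toContinuousMap := rfl
        rw [this, map_smul, real_smul_clm_apply, inner_smul_right, RCLike.re_ofReal_mul]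
        rfl }
  let Λ := PositiveLinearMap.mk₀ L fun f hf => re_inner_contCalc_nonneg hA (fun t => CompactlySupportedContinuousMap.le_def.1 hf t) ψ
  refine ⟨RealRMK.rieszMeasure Λ, inferInstance, fun f => ?_⟩
  have := RealRMK.integral_rieszMeasure Λ ⟨f, HasCompactSupport.of_compactSpace _⟩
  exact this.symm

theorem RepresentsVector.norm_contCalc_sq (hA : IsSelfAdjoint A) {ψ : H}
    {ν : Measure (realSpectrum A)} (h : RepresentsVector A ψ ν) (f : C(realSpectrum A, ℝ)) :
    ‖contCalc A f ψ‖ ^ 2 = ∫ t, f t ^ 2 ∂ν := by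
  rw [norm_contCalc_apply_sq hA, h.re_inner_eq]
  simp [sq]

theorem RepresentsVector.isSpectralMeasure (hA : IsSelfAdjoint A) {ψ : H}
    {ν : Measure (realSpectrum A)} (h : RepresentsVector A ψ ν) :
    IsSpectralMeasure A ψ (ν.map Subtype.val) := by
  have hfin := h.isFinite
  have hm : MeasurableSet (realSpectrum A) := (isCompact_realSpectrum A).measurableSet
  refine ⟨inferInstance, ?_, fun p => ?_⟩
  · rw [Measure.map_apply measurable_subtype_coe hm.compl]
    simp
  · rw [(MeasurableEmbedding.subtype_coe hm).integral_map]
    have hint : ∀ p : 𝕜[X], Integrable (fun t : realSpectrum A => p.eval ((t : ℝ) : 𝕜)) ν := by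
      intro p
      refine Continuous.integrable_of_hasCompactSupport ?_ (HasCompactSupport.of_compactSpace _)
      fun_prop
    induction p using Polynomial.induction_on' with
    | add p q hp hq =>
      rw [map_add, add_apply, inner_add_right, hp, hq, ← integral_add (hint p) (hint q)]
      simp only [eval_add]
    | monomial n a =>
      have h1 := h.re_inner_eq (polyOnSpectrum A (X ^ n))
      have h2 := inner_contCalc_self hA (polyOnSpectrum A (X ^ n)) ψ
      rw [h1, contCalc_poly hA, map_pow, aeval_X] at h2
      rw [aeval_monomial, mul_apply_eq_comp]
      have h3 : algebraMap 𝕜 (H →L[𝕜] H) a ((A ^ n) ψ) = a • (A ^ n) ψ := rfl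
      rw [h3, inner_smul_right, h2]
      simp only [eval_monomial]
      rw [integral_const_mul, ← integral_ofReal]
      simp [polyOnSpectrum_apply]

/-- Both sides of the representation are continuous in the sup norm, so the identity for polynomials
extends to continuous functions. -/
theorem RepresentsVector.of_isSpectralMeasure (hA : IsSelfAdjoint A) {ψ : H} {μ : Measure ℝ}
    (h : IsSpectralMeasure A ψ μ) :
    RepresentsVector A ψ (μ.comap Subtype.val) ∧
      (μ.comap (Subtype.val : realSpectrum A → ℝ)).map Subtype.val = μ := by
  have hfin := h.isFinite
  have hm : MeasurableSet (realSpectrum A) := (isCompact_realSpectrum A).measurableSet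
  have hemb := MeasurableEmbedding.subtype_coe hm
  have hmap : (μ.comap (Subtype.val : realSpectrum A → ℝ)).map Subtype.val = μ := by
    rw [hemb.map_comap, Subtype.range_coe]
    exact Measure.restrict_eq_self_of_ae_mem h.carried
  set ν := μ.comap (Subtype.val : realSpectrum A → ℝ) with hν
  have hfinν : IsFiniteMeasure ν := by
    constructor
    rw [hν, hemb.comap_apply]
    exact measure_lt_top _ _
  refine ⟨⟨hfinν, fun f => ?_⟩, hmap⟩
  induction f using contCalc_induction with
  | hP =>
    refine isClosed_eq (by fun_prop) ?_
    have : (fun f : C(realSpectrum A, ℝ) => ∫ t, f t ∂ν) =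
        fun f => ∫ t, (ContinuousMap.toLp (E := ℝ) 1 ν ℝ f) t ∂ν := by
      funext f
      exact integral_congr_ae (ContinuousMap.coeFn_toLp ν f).symm
    rw [this]
    exact continuous_integral.comp (ContinuousMap.toLp (E := ℝ) 1 ν ℝ).continuous
  | h p =>
    have h1 := h.inner_eq (p.map (algebraMap ℝ 𝕜))
    rw [← hmap, hemb.integral_map, aeval_map_ofReal] at h1
    rw [contCalc_poly hA, h1]
    have h2 : ∀ t : ℝ, (p.map (algebraMap ℝ 𝕜)).eval (t : 𝕜) = ((p.eval t : ℝ) : 𝕜) := by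
      intro t
      rw [eval_map, eval₂_eq_eval_map, ← RCLike.algebraMap_eq_ofReal, eval_map_algebraMap,
        aeval_algebraMap_apply]; rfl
    simp only [h2]
    rw [integral_ofReal, RCLike.ofReal_re]
    rfl

end SpectralMeasures

/-! ### Cutting vectors by closed sets; atoms and eigenvectors. -/

section SpectralCuts

variable {𝕜 H : Type*} [RCLike 𝕜] [NormedAddCommGroup H] [InnerProductSpace 𝕜 H] [CompleteSpace H]

theorem exists_tendsto_indicator {X : Type*} [PseudoEMetricSpace X] {K : Set X}
    (hK : IsClosed K) : ∃ h : ℕ → C(X, ℝ), (∀ n x, 0 ≤ h n x ∧ h n x ≤ 1) ∧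
      (∀ n, ∀ x ∈ K, h n x = 1) ∧ ∀ x, Tendsto (fun n => h n x) atTop (𝓝 (K.indicator 1 x)) := by
  have hpos : ∀ n : ℕ, 0 < 1 / ((n : ℝ) + 1) := fun n => by positivity
  refine ⟨fun n => ⟨fun x => (thickenedIndicator (hpos n) K x : ℝ), by fun_prop⟩,
    fun n x => ⟨NNReal.coe_nonneg _, ?_⟩, fun n x hx => ?_, fun x => ?_⟩
  · exact_mod_cast thickenedIndicator_le_one (hpos n) K x
  · exact congrArg NNReal.toReal (thickenedIndicator_one (hpos n) K hx)
  · have h := tendsto_pi_nhds.1 (thickenedIndicator_tendsto_indicator_closure hpos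
      tendsto_one_div_add_atTop_nhds_zero_nat K) x
    rw [hK.closure_eq] at h
    have h2 := (NNReal.continuous_coe.tendsto _).comp h
    refine h2.congr' (Eventually.of_forall fun n => rfl) |>.trans_eq ?_
    congr 1
    by_cases hx : x ∈ K <;> simp [hx]

variable [Nontrivial H] {A : H →L[𝕜] H}

/-- The vector `φ = χ_K(A) ψ` for a closed set `K`. -/
theorem RepresentsVector.exists_restrict (hA : IsSelfAdjoint A) {ψ : H}
    {ν : Measure (realSpectrum A)} (hν : RepresentsVector A ψ ν) {K : Set (realSpectrum A)}
    (hK : IsClosed K) : ∃ φ : H, RepresentsVector A φ (ν.restrict K) ∧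
      RCLike.re (inner 𝕜 ψ φ) = ν.real K ∧
      ∀ t ∈ K, ∀ v : H, A v = ((t : ℝ) : 𝕜) • v → inner 𝕜 v φ = inner 𝕜 v ψ := by
  have hfin := hν.isFinite
  obtain ⟨h, h01, hone, hlim⟩ := exists_tendsto_indicator hK
  have hdct : ∀ G : ℝ → ℝ, Continuous G → ∀ f : C(realSpectrum A, ℝ), Tendsto
      (fun n => ∫ t, f t * G (h n t) ∂ν) atTop (𝓝 (∫ t, f t * G (K.indicator 1 t) ∂ν)) := by
    intro G hG f
    obtain ⟨C, hC⟩ := (isCompact_Icc (a := (0 : ℝ)) (b := 1)).exists_bound_of_continuousOn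
      hG.continuousOn
    refine tendsto_integral_of_dominated_convergence (fun _ => ‖f‖ * C) (fun n => ?_)
      (integrable_const _) (fun n => ae_of_all _ fun t => ?_) (ae_of_all _ fun t => ?_)
    · exact Continuous.aestronglyMeasurable (by fun_prop)
    · rw [norm_mul]
      exact mul_le_mul (f.norm_coe_le_norm t) (hC _ (h01 n t)) (norm_nonneg _) (norm_nonneg _)
    · exact ((hG.tendsto _).comp (hlim t)).const_mul _
  have hind : ∀ t, (K.indicator 1 t : ℝ) ^ 2 = K.indicator 1 t := by
    intro t
    by_cases ht : t ∈ K <;> simp [ht]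
  have hindint : ∀ f : C(realSpectrum A, ℝ), ∫ t, f t * K.indicator 1 t ∂ν = ∫ t in K, f t ∂ν := by
    intro f
    rw [← integral_indicator hK.measurableSet]
    congr 1
    funext t
    by_cases ht : t ∈ K <;> simp [ht]
  -- The map `f ↦ f(A) ψ` is isometric for the norm of `L²(ν)`, and `h n` tends to `χ_K` there by
  -- dominated convergence.
  have hcauchy : CauchySeq fun n => contCalc A (h n) ψ := by
    have hmeas : ∀ n, AEStronglyMeasurable (fun t => (h n t - K.indicator 1 t) ^ 2) ν := by
      intro n
      refine ((h n).continuous.measurable.sub ?_).pow_const 2 |>.aestronglyMeasurable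
      exact measurable_one.indicator hK.measurableSet
    have hbd : ∀ n t, ‖(h n t - K.indicator 1 t) ^ 2‖ ≤ 1 := by
      intro n t
      have := h01 n t
      rw [Real.norm_eq_abs, abs_pow, sq_le_one_iff_abs_le_one, abs_abs, abs_le]
      by_cases ht : t ∈ K <;> simp only [ht, Set.indicator_of_mem, Set.indicator_of_notMem,
        not_false_eq_true, Pi.one_apply] <;> constructor <;> linarith
    have hint : ∀ n, Integrable (fun t => (h n t - K.indicator 1 t) ^ 2) ν := fun n =>
      Integrable.of_bound (C := 1) (hmeas n) (ae_of_all _ (hbd n))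
    have hdist : ∀ n m, ‖contCalc A (h n) ψ - contCalc A (h m) ψ‖ ^ 2 ≤
        2 * ∫ t, (h n t - K.indicator 1 t) ^ 2 ∂ν + 2 * ∫ t, (h m t - K.indicator 1 t) ^ 2 ∂ν := by
      intro n m
      rw [← sub_apply, ← map_sub, hν.norm_contCalc_sq hA, ← integral_const_mul,
        ← integral_const_mul, ← integral_add ((hint n).const_mul 2) ((hint m).const_mul 2)]
      refine integral_mono ?_ (((hint n).const_mul 2).add ((hint m).const_mul 2)) fun t => ?_
      · exact integrable_continuousMap ν ((h n - h m) ^ 2)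
      · simp only [ContinuousMap.sub_apply]
        nlinarith [sq_nonneg (h n t - K.indicator 1 t + (h m t - K.indicator 1 t))]
    have hlim0 : Tendsto (fun n => ∫ t, (h n t - K.indicator 1 t) ^ 2 ∂ν) atTop (𝓝 0) := by
      rw [← integral_zero (realSpectrum A) ℝ (μ := ν)]
      refine tendsto_integral_of_dominated_convergence (fun _ => 1) hmeas (integrable_const _)
        (fun n => ae_of_all _ (hbd n)) (ae_of_all _ fun t => ?_)
      have := ((hlim t).sub_const (K.indicator 1 t)).pow 2
      rwa [sub_self, zero_pow two_ne_zero] at this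
    rw [Metric.cauchySeq_iff']
    intro ε hε
    obtain ⟨N, hN⟩ := eventually_atTop.1 (hlim0.eventually_lt_const
      (show (0 : ℝ) < ε ^ 2 / 4 by positivity))
    refine ⟨N, fun n hn => ?_⟩
    rw [dist_eq_norm]
    refine lt_of_pow_lt_pow_left₀ 2 hε.le ?_
    have h1 := hdist n N
    have h2 := hN n hn
    have h3 := hN N le_rfl
    linarith
  obtain ⟨φ, hφ⟩ := cauchySeq_tendsto_of_complete hcauchy
  refine ⟨φ, ⟨inferInstance, fun f => ?_⟩, ?_, fun t ht v hv => ?_⟩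
  · have h1 : Tendsto (fun n => RCLike.re (inner 𝕜 (contCalc A (h n) ψ)
        (contCalc A f (contCalc A (h n) ψ)))) atTop (𝓝 (RCLike.re (inner 𝕜 φ (contCalc A f φ)))) :=
      (RCLike.continuous_re.tendsto _).comp
        (hφ.inner (((contCalc A f).continuous.tendsto _).comp hφ))
    refine tendsto_nhds_unique h1 ?_
    have h2 := hdct (fun x => x ^ 2) (by fun_prop) f
    simp only [hind, hindint] at h2
    refine h2.congr fun n => ?_
    rw [inner_contCalc_left hA, ← contCalc_mul_apply hA, ← contCalc_mul_apply hA, hν.re_inner_eq]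
    congr 1
    funext t
    simp only [ContinuousMap.mul_apply]
    ring
  · have h1 : Tendsto (fun n => RCLike.re (inner 𝕜 ψ (contCalc A (h n) ψ))) atTop
        (𝓝 (RCLike.re (inner 𝕜 ψ φ))) :=
      (RCLike.continuous_re.tendsto _).comp (tendsto_const_nhds.inner hφ)
    refine tendsto_nhds_unique h1 ?_
    have h2 := hdct (fun x => x) (by fun_prop) 1
    rw [hindint] at h2
    simp only [hν.re_inner_eq]
    simpa using h2
  · have h1 : Tendsto (fun n => inner 𝕜 v (contCalc A (h n) ψ)) atTop (𝓝 (inner 𝕜 v φ)) :=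
      tendsto_const_nhds.inner hφ
    refine tendsto_nhds_unique h1 (tendsto_const_nhds.congr fun n => ?_)
    rw [← inner_contCalc_left hA, contCalc_apply_of_eigen hA hv, hone n t ht]
    simp

theorem RepresentsVector.norm_sq (hA : IsSelfAdjoint A) {ψ : H}
    {ν : Measure (realSpectrum A)} (h : RepresentsVector A ψ ν) : ‖ψ‖ ^ 2 = ν.real Set.univ := by
  have h1 := h.norm_contCalc_sq hA 1
  rw [contCalc_one hA] at h1
  simpa using h1

/-- The vector `χ_{t}(A) ψ` has squared norm `ν {t} = 0`, yet its inner product with `v` is that of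
`ψ`. -/
theorem RepresentsVector.inner_eigen_eq_zero (hA : IsSelfAdjoint A) {ψ : H}
    {ν : Measure (realSpectrum A)} (h : RepresentsVector A ψ ν) (hatom : ∀ t, ν {t} = 0)
    {t : ℝ} {v : H} (hv : A v = (t : 𝕜) • v) : inner 𝕜 v ψ = 0 := by
  by_cases hv0 : v = 0
  · rw [hv0, inner_zero_left]
  have ht := mem_realSpectrum_of_eigen hv0 hv
  obtain ⟨φ, hφ, -, hin⟩ := h.exists_restrict hA (isClosed_singleton (x := ⟨t, ht⟩))
  have h0 := hφ.norm_sq hA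
  rw [measureReal_def, Measure.restrict_apply_univ, hatom] at h0
  have hφ0 : φ = 0 := by simpa using h0
  rw [← hin _ rfl v hv, hφ0, inner_zero_right]

/-- For `φ = χ_{t}(A) ψ` one has `‖(A - t)φ‖² = ∫_{t} (s - t)² dν = 0`. So `φ` is orthogonal to `ψ`,
while `Re ⟨ψ, φ⟩ = ν {t}`. -/
theorem RepresentsVector.measure_singleton (hA : IsSelfAdjoint A) {ψ : H}
    {ν : Measure (realSpectrum A)} (h : RepresentsVector A ψ ν)
    (horth : ∀ (t : ℝ) (v : H), A v = (t : 𝕜) • v → inner 𝕜 v ψ = 0) (t : realSpectrum A) :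
    ν {t} = 0 := by
  have hfin := h.isFinite
  obtain ⟨φ, hφ, hre, -⟩ := h.exists_restrict hA (isClosed_singleton (x := t))
  have heig : A φ = ((t : ℝ) : 𝕜) • φ := by
    have h1 := hφ.norm_contCalc_sq hA (polyOnSpectrum A (X - C (t : ℝ)))
    rw [contCalc_poly hA] at h1
    have h2 : ∫ s in {t}, (polyOnSpectrum A (X - C (t : ℝ)) s) ^ 2 ∂ν = 0 := by
      rw [integral_singleton, polyOnSpectrum_apply]
      simp
    rw [h2, map_sub, aeval_X, aeval_C, sub_apply, algebraMap_real_clm_apply] at h1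
    exact sub_eq_zero.1 (by simpa using h1)
  rw [← inner_conj_symm, horth t φ heig] at hre
  rw [map_zero, map_zero] at hre
  exact (measureReal_eq_zero_iff (by finiteness)).1 hre.symm

/-- If the continuous subspace is trivial, then the eigenvectors are total. -/
theorem eq_zero_of_contSubspace_eq_bot (hA : IsSelfAdjoint A) (hc : contSubspace A = ⊥) {ψ : H}
    (horth : ∀ (t : ℝ) (v : H), A v = (t : 𝕜) • v → inner 𝕜 v ψ = 0) : ψ = 0 := by
  obtain ⟨ν, hν⟩ := exists_representsVector hA ψ
  have hfin := hν.isFinite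
  have hm : MeasurableSet (realSpectrum A) := (isCompact_realSpectrum A).measurableSet
  have hemb := MeasurableEmbedding.subtype_coe hm
  have hatom := hν.measure_singleton hA horth
  have hac : ∀ φ ∈ acSubspace A, φ = 0 := fun φ hφ => by
    have : φ ∈ contSubspace A := Submodule.mem_sup_left hφ
    rwa [hc, Submodule.mem_bot] at this
  have hsc : ∀ φ ∈ scSubspace A, φ = 0 := fun φ hφ => by
    have : φ ∈ contSubspace A := Submodule.mem_sup_right hφ
    rwa [hc, Submodule.mem_bot] at this
  by_cases habs : (ν.map Subtype.val).AbsolutelyContinuous volume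
  · exact hac ψ (Submodule.subset_span ⟨_, hν.isSpectralMeasure hA, habs⟩)
  exfalso
  -- Inner regularity gives a compact Lebesgue-null `K` of positive measure. Then `χ_K(A) ψ` lies in
  -- `H_sc`, and it is nonzero because `Re ⟨ψ, χ_K(A) ψ⟩ = ν(K)`.
  obtain ⟨S, hSm, hS0, hS⟩ : ∃ S, MeasurableSet S ∧ volume S = 0 ∧ (ν.map Subtype.val) S ≠ 0 := by
    by_contra! hcon
    exact habs (Measure.AbsolutelyContinuous.mk fun s hs h0 => hcon s hs h0)
  obtain ⟨K, hKS, hK, hKpos⟩ := hSm.exists_lt_isCompact (pos_iff_ne_zero.2 hS)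
  rw [Measure.map_apply measurable_subtype_coe hK.measurableSet] at hKpos
  obtain ⟨φ, hφ, hre, -⟩ := hν.exists_restrict hA (hK.isClosed.preimage continuous_subtype_val)
  have hφ0 : φ = 0 := by
    refine hsc φ (Submodule.subset_span ⟨_, hφ.isSpectralMeasure hA, ?_, fun t => ?_⟩)
    · refine ⟨Kᶜ, hK.measurableSet.compl, ?_, ?_⟩
      · rw [Measure.map_apply measurable_subtype_coe hK.measurableSet.compl,
          Measure.restrict_apply (measurable_subtype_coe hK.measurableSet.compl)]
        simp
      · rw [compl_compl]
        exact measure_mono_null hKS hS0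
    · rw [hemb.map_apply]
      refine Measure.absolutelyContinuous_of_le Measure.restrict_le_self ?_
      have hsub : (Subtype.val ⁻¹' {t} : Set (realSpectrum A)).Subsingleton :=
        fun x hx y hy => Subtype.ext (Eq.trans hx (Eq.symm hy))
      rcases hsub.eq_empty_or_singleton with h | ⟨x, h⟩ <;> rw [h]
      · exact measure_empty
      · exact hatom x
  rw [hφ0, inner_zero_right, map_zero] at hre
  exact hKpos.ne' ((measureReal_eq_zero_iff (by finiteness)).1 hre.symm)

theorem exists_representsVector_of_contSubspace_ne_bot (hA : IsSelfAdjoint A)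
    (hc : contSubspace A ≠ ⊥) :
    ∃ (ψ : H) (ν : _), ψ ≠ 0 ∧ RepresentsVector A ψ ν ∧ ∀ t, ν {t} = 0 := by
  have key : ∃ (ψ : H) (μ : Measure ℝ), ψ ≠ 0 ∧ IsSpectralMeasure A ψ μ ∧ ∀ t, μ {t} = 0 := by
    by_contra! hcon
    refine hc (sup_eq_bot_iff.2 ⟨?_, ?_⟩)
    · refine Submodule.span_eq_bot.2 ?_
      rintro ψ ⟨μ, hμ, hac⟩
      by_contra h0
      obtain ⟨t, ht⟩ := hcon ψ μ h0 hμ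
      exact ht (hac (measure_singleton t))
    · refine Submodule.span_eq_bot.2 ?_
      rintro ψ ⟨μ, hμ, -, hat⟩
      by_contra h0
      obtain ⟨t, ht⟩ := hcon ψ μ h0 hμ
      exact ht (hat t)
  obtain ⟨ψ, μ, h0, hμ, hat⟩ := key
  refine ⟨ψ, _, h0, (RepresentsVector.of_isSpectralMeasure hA hμ).1, fun t => ?_⟩
  rw [(MeasurableEmbedding.subtype_coe (isCompact_realSpectrum A).measurableSet).comap_apply,
    Set.image_singleton]
  exact hat _

end SpectralCuts

/-! ### Form-preserving contractions and extreme eigenspaces. -/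

section Rigidity

variable {𝕜 H : Type*} [RCLike 𝕜] [NormedAddCommGroup H] [InnerProductSpace 𝕜 H]

/-- A bounded operator that leaves the members of an orthogonal family invariant and has a
nonnegative form on each of them has a nonnegative form on the closed span. -/
theorem re_inner_nonneg_of_orthogonal {ι : Type*} {V : ι → Submodule 𝕜 H}
    (hV : ∀ i j, i ≠ j → ∀ x ∈ V i, ∀ y ∈ V j, inner 𝕜 x y = 0) (S : H →L[𝕜] H)
    (hS : ∀ i, ∀ x ∈ V i, S x ∈ V i) (hpos : ∀ i, ∀ x ∈ V i, 0 ≤ RCLike.re (inner 𝕜 x (S x)))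
    {x : H} (hx : x ∈ (⨆ i, V i).topologicalClosure) : 0 ≤ RCLike.re (inner 𝕜 x (S x)) := by
  have hclosed : IsClosed {x : H | 0 ≤ RCLike.re (inner 𝕜 x (S x))} := by
    refine isClosed_le continuous_const (RCLike.continuous_re.comp ?_)
    exact continuous_id.inner S.continuous
  refine closure_minimal (fun y hy => ?_) hclosed hx
  obtain ⟨f, hf, rfl⟩ := (Submodule.mem_iSup_iff_exists_finsupp _ _).1 hy
  have : inner 𝕜 (f.sum fun _ x => x) (S (f.sum fun _ x => x)) =
      ∑ i ∈ f.support, inner 𝕜 (f i) (S (f i)) := by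
    rw [Finsupp.sum, map_sum, sum_inner]
    refine Finset.sum_congr rfl fun i hi => ?_
    rw [inner_sum]
    exact Finset.sum_eq_single_of_mem i hi fun j _ hj =>
      hV i j hj.symm _ (hf i) _ (hS j _ (hf j))
  rw [Set.mem_ofPred_eq, this, map_sum]
  exact Finset.sum_nonneg fun i _ => hpos i _ (hf i)

/-- Cauchy–Schwarz for the nonnegative form of `S` on `L`, obtained by testing on `x + r S x`. -/
theorem apply_eq_zero_of_re_inner_eq_zero {S : H →L[𝕜] H}
    (hsymm : ∀ x y, inner 𝕜 (S x) y = inner 𝕜 x (S y)) {L : Submodule 𝕜 H}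
    (hSL : ∀ x ∈ L, S x ∈ L) (hpos : ∀ x ∈ L, 0 ≤ RCLike.re (inner 𝕜 x (S x))) {x : H}
    (hx : x ∈ L) (h0 : RCLike.re (inner 𝕜 x (S x)) ≤ 0) : S x = 0 := by
  set b := RCLike.re (inner 𝕜 (S x) (S (S x))) with hb
  have hb0 : 0 ≤ b := hpos _ (hSL _ hx)
  have key : ∀ r : ℝ, 0 ≤ 2 * r * ‖S x‖ ^ 2 + r ^ 2 * b := by
    intro r
    have h := hpos _ (L.add_mem hx (L.smul_mem (r : 𝕜) (hSL _ hx)))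
    rw [map_add, map_smul, inner_add_left, inner_add_right, inner_add_right, inner_smul_left,
      inner_smul_left, inner_smul_right, inner_smul_right, RCLike.conj_ofReal, ← hsymm x (S x),
      map_add, map_add, map_add, RCLike.re_ofReal_mul, RCLike.re_ofReal_mul, RCLike.re_ofReal_mul,
      inner_self_eq_norm_sq, ← hb] at h
    nlinarith
  -- Dividing by `b + 1` instead of `b` covers `b = 0` as well.
  have h1 := key (-(‖S x‖ ^ 2 / (b + 1)))
  have hb1 : 0 < b + 1 := by linarith
  have h2 : 2 * -(‖S x‖ ^ 2 / (b + 1)) * ‖S x‖ ^ 2 + (-(‖S x‖ ^ 2 / (b + 1))) ^ 2 * b =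
      -((‖S x‖ ^ 2 / (b + 1)) ^ 2 * (b + 2)) := by
    field_simp
    ring
  rw [h2] at h1
  have h3 : (‖S x‖ ^ 2 / (b + 1)) ^ 2 = 0 := by
    have : 0 ≤ (‖S x‖ ^ 2 / (b + 1)) ^ 2 := by positivity
    nlinarith
  have h4 : ‖S x‖ ^ 2 / (b + 1) = 0 := by simpa using h3
  rw [div_eq_zero_iff] at h4
  rcases h4 with h4 | h4
  · simpa using h4
  · linarith

theorem mem_realEigenspace {A : H →L[𝕜] H} {t : ℝ} {x : H} :
    x ∈ realEigenspace A t ↔ A x = (t : 𝕜) • x :=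
  Module.End.mem_eigenspace_iff

theorem realEigenspace_eq_bot {A : H →L[𝕜] H} {t : ℝ} (ht : t ∉ pointSpectrum A) :
    realEigenspace A t = ⊥ := by
  by_contra h
  exact ht h

theorem inner_realEigenspace {A : H →L[𝕜] H} (hA : ∀ x y, inner 𝕜 (A x) y = inner 𝕜 x (A y))
    {s t : ℝ} (hst : s ≠ t) {x y : H} (hx : x ∈ realEigenspace A s)
    (hy : y ∈ realEigenspace A t) : inner 𝕜 x y = 0 := by
  have h := hA x y
  rw [mem_realEigenspace.1 hx, mem_realEigenspace.1 hy, inner_smul_left, inner_smul_right,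
    RCLike.conj_ofReal, ← sub_eq_zero, ← sub_mul, ← RCLike.ofReal_sub, mul_eq_zero] at h
  rcases h with h | h
  · exact absurd (sub_eq_zero.1 (by exact_mod_cast h)) hst
  · exact h

/-- An operator preserving the form of `A` preserves the orthogonal complement of eigenspaces that
it maps onto supersets of themselves. -/
theorem form_preserving_orthogonal {A : H →L[𝕜] H} {S : H →ₗ[𝕜] H}
    (hS : ∀ x y, inner 𝕜 (A (S x)) (S y) = inner 𝕜 (A x) y) {G : Set ℝ} (h0 : ∀ t ∈ G, t ≠ 0)
    (hG : ∀ t ∈ G, ∀ y ∈ realEigenspace A t, ∃ z ∈ realEigenspace A t, S z = y) {x : H}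
    (hx : ∀ t ∈ G, ∀ y ∈ realEigenspace A t, inner 𝕜 y x = 0) :
    ∀ t ∈ G, ∀ y ∈ realEigenspace A t, inner 𝕜 y (S x) = 0 := by
  intro t ht y hy
  obtain ⟨z, hz, rfl⟩ := hG t ht y hy
  -- With `y = S z` this reads `t ⟨y, S x⟩`, up to the order of factors, equals `t ⟨z, x⟩ = 0`.
  have h := hS z x
  rw [mem_realEigenspace.1 hz, mem_realEigenspace.1 hy, inner_smul_left, inner_smul_left,
    hx t ht z hz, mul_zero, mul_eq_zero] at h
  rcases h with h | h
  · exact absurd (by simpa using h) (h0 t ht)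
  · exact h

variable [CompleteSpace H]

/-- Split `x = p + r` along the closed span. The part `r` is orthogonal to the eigenspaces in `B` by
construction and to the others because `x` and `p` are, so totality gives `r = 0`. -/
theorem mem_closure_iSup_realEigenspace {A : H →L[𝕜] H}
    (hA : ∀ x y, inner 𝕜 (A x) y = inner 𝕜 x (A y))
    (htotal : ∀ x : H, (∀ t, ∀ v ∈ realEigenspace A t, inner 𝕜 v x = 0) → x = 0)
    {B : Set ℝ} {x : H}
    (hx : ∀ t ∈ pointSpectrum A \ B, ∀ y ∈ realEigenspace A t, inner 𝕜 y x = 0) :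
    x ∈ (⨆ t : B, realEigenspace A t).topologicalClosure := by
  set M := (⨆ t : B, realEigenspace A t).topologicalClosure with hM
  have hKM : ∀ t ∈ B, realEigenspace A t ≤ M := fun t ht =>
    (le_iSup (fun t : B => realEigenspace A t) ⟨t, ht⟩).trans (Submodule.le_topologicalClosure _)
  have : CompleteSpace M := (Submodule.isClosed_topologicalClosure _).completeSpace_coe
  obtain ⟨p, hp, r, hr, rfl⟩ := M.exists_add_mem_mem_orthogonal x
  have horth : ∀ t ∈ pointSpectrum A \ B, ∀ y ∈ realEigenspace A t, inner 𝕜 y p = 0 := by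
    intro t ht y hy
    have hle : M ≤ (𝕜 ∙ y)ᗮ := by
      refine Submodule.topologicalClosure_minimal _ (iSup_le fun s z hz => ?_)
        (Submodule.isClosed_orthogonal _)
      rw [Submodule.mem_orthogonal_singleton_iff_inner_right]
      exact inner_realEigenspace hA (fun h : t = s => ht.2 (h ▸ s.2)) hy hz
    exact Submodule.mem_orthogonal_singleton_iff_inner_right.1 (hle hp)
  have hr0 : r = 0 := by
    refine htotal r fun t v hv => ?_
    by_cases htB : t ∈ B
    · exact hr v (hKM t htB hv)
    · by_cases htp : t ∈ pointSpectrum A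
      · have := hx t ⟨htp, htB⟩ v hv
        rwa [inner_add_right, horth t ⟨htp, htB⟩ v hv, zero_add] at this
      · rw [realEigenspace_eq_bot htp, Submodule.mem_bot] at hv
        rw [hv, inner_zero_left]
  rw [hr0, add_zero]
  exact hp

/-- Let `A` be bounded by `m` (up to the sign `e`) on the eigenspaces belonging to `B`, and let `S`
preserve the form of `A` and the orthogonal complement of the other eigenspaces. If `S` does not
increase `e • m * ‖x‖ ^ 2` then it preserves the eigenspace of `m`. -/
theorem form_preserving_extreme_eigenspace {A : H →L[𝕜] H}
    (hA : ∀ x y, inner 𝕜 (A x) y = inner 𝕜 x (A y))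
    (htotal : ∀ x : H, (∀ t, ∀ v ∈ realEigenspace A t, inner 𝕜 v x = 0) → x = 0)
    {B : Set ℝ} (h0 : ∀ t ∈ pointSpectrum A, 0 < t) {S : H →ₗ[𝕜] H}
    (hS : ∀ x y, inner 𝕜 (A (S x)) (S y) = inner 𝕜 (A x) y)
    (hG : ∀ t ∈ pointSpectrum A \ B, ∀ y ∈ realEigenspace A t,
      ∃ z ∈ realEigenspace A t, S z = y)
    {m e : ℝ} (hmB : m ∈ B) (hm : ∀ t ∈ B, 0 ≤ e * (m - t))
    (hcontr : ∀ x, e * m * ‖S x‖ ^ 2 ≤ e * m * ‖x‖ ^ 2) (he : e ≠ 0) {x : H}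
    (hx : x ∈ realEigenspace A m) : S x ∈ realEigenspace A m := by
  -- The operator `e (m - A)` is nonnegative on `L`, which lies in the closed span of the
  -- eigenspaces in `B`. There, a vector on which its form vanishes is in its kernel.
  let D : H →L[𝕜] H := (e : 𝕜) • ((m : 𝕜) • (1 : H →L[𝕜] H) - A)
  have hD : ∀ y, D y = (e : 𝕜) • ((m : 𝕜) • y - A y) := fun y => rfl
  let L : Submodule 𝕜 H := (⨆ t : ↥(pointSpectrum A \ B), realEigenspace A t)ᗮ
  have hL : ∀ y, y ∈ L ↔ ∀ t ∈ pointSpectrum A \ B, ∀ z ∈ realEigenspace A t, inner 𝕜 z y = 0 := by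
    intro y
    simp only [L, ← Submodule.iInf_orthogonal, Submodule.mem_iInf, Submodule.mem_orthogonal,
      Subtype.forall]
  have hxL : x ∈ L := (hL x).2 fun t ht z hz =>
    inner_realEigenspace hA (fun h : t = m => ht.2 (h ▸ hmB)) hz hx
  have hSxL : S x ∈ L := (hL _).2 (form_preserving_orthogonal hS
    (fun t ht => (h0 t ht.1).ne') hG ((hL x).1 hxL))
  have hDsymm : ∀ x y, inner 𝕜 (D x) y = inner 𝕜 x (D y) := by
    intro x y
    simp only [hD, inner_smul_left, inner_smul_right, inner_sub_left, inner_sub_right, hA,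
      RCLike.conj_ofReal]
  have hDeig : ∀ t, ∀ y ∈ realEigenspace A t, D y = ((e * (m - t) : ℝ) : 𝕜) • y := by
    intro t y hy
    rw [hD, mem_realEigenspace.1 hy, ← sub_smul, smul_smul]
    push_cast
    rfl
  have hDL : ∀ y ∈ L, D y ∈ L := by
    intro y hy
    rw [hL] at hy ⊢
    intro t ht z hz
    rw [← hDsymm, hDeig t z hz, inner_smul_left, hy t ht z hz, mul_zero]
  have hDpos : ∀ y ∈ L, 0 ≤ RCLike.re (inner 𝕜 y (D y)) := by
    intro y hy
    refine re_inner_nonneg_of_orthogonal (V := fun t : B => realEigenspace A t)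
      (fun s t hst x hx y hy => inner_realEigenspace hA (fun h => hst (Subtype.ext h)) hx hy) D
      (fun t z hz => ?_) (fun t z hz => ?_)
      (mem_closure_iSup_realEigenspace hA htotal ((hL y).1 hy))
    · rw [hDeig t z hz]
      exact Submodule.smul_mem _ _ hz
    · rw [hDeig t z hz, inner_smul_right, RCLike.re_ofReal_mul, inner_self_eq_norm_sq]
      exact mul_nonneg (hm t t.2) (by positivity)
  have hq : ∀ y, RCLike.re (inner 𝕜 y (D y)) =
      e * m * ‖y‖ ^ 2 - e * RCLike.re (inner 𝕜 (A y) y) := by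
    intro y
    rw [hD, inner_smul_right, inner_sub_right, inner_smul_right, RCLike.re_ofReal_mul, map_sub,
      RCLike.re_ofReal_mul, inner_self_eq_norm_sq, hA]
    ring
  have hDx : RCLike.re (inner 𝕜 (S x) (D (S x))) ≤ 0 := by
    have h1 : RCLike.re (inner 𝕜 x (D x)) = 0 := by
      rw [hDeig m x hx, sub_self, mul_zero, RCLike.ofReal_zero, zero_smul, inner_zero_right,
        map_zero]
    rw [hq] at h1 ⊢
    rw [hS]
    linarith [hcontr x]
  have h := apply_eq_zero_of_re_inner_eq_zero hDsymm hDL hDpos hSxL hDx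
  rw [hD, smul_eq_zero, sub_eq_zero] at h
  rcases h with h | h
  · exact absurd (by simpa using h) he
  · exact mem_realEigenspace.2 h.symm

/-- A contraction preserving the form of `A` is isometric, if the eigenvectors of `A` are total and
the eigenvalues satisfy the extremum condition. -/
theorem norm_eq_of_form_preserving {A : H →L[𝕜] H}
    (hA : ∀ x y, inner 𝕜 (A x) y = inner 𝕜 x (A y))
    (htotal : ∀ x : H, (∀ t, ∀ v ∈ realEigenspace A t, inner 𝕜 v x = 0) → x = 0)
    (h0 : ∀ t ∈ pointSpectrum A, 0 < t)
    (hext : ∀ B : Set ℝ, B ⊆ pointSpectrum A → B.Nontrivial →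
        (∃ m, IsGreatest B m ∧ HasFiniteMultiplicity A m) ∨
        (∃ m, IsLeast B m ∧ HasFiniteMultiplicity A m))
    {T : H ≃ₗ[𝕜] H} (hT : ∀ x y, inner 𝕜 (A (T x)) (T y) = inner 𝕜 (A x) y)
    (hcontr : ∀ x, ‖T x‖ ≤ ‖x‖) (x : H) : ‖T x‖ = ‖x‖ := by
  let B : Set ℝ := {t ∈ pointSpectrum A | (realEigenspace A t).map (T : H →ₗ[𝕜] H) ≠
    realEigenspace A t}
  have hB : ∀ t ∈ pointSpectrum A \ B, (realEigenspace A t).map (T : H →ₗ[𝕜] H) =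
      realEigenspace A t := by
    intro t ht
    by_contra h
    exact ht.2 ⟨ht.1, h⟩
  have hTsymm : ∀ x y, inner 𝕜 (A (T.symm x)) (T.symm y) = inner 𝕜 (A x) y := by
    intro x y
    rw [← hT, T.apply_symm_apply, T.apply_symm_apply]
  have hG : ∀ t ∈ pointSpectrum A \ B, ∀ y ∈ realEigenspace A t,
      ∃ z ∈ realEigenspace A t, (T : H →ₗ[𝕜] H) z = y := by
    intro t ht y hy
    rw [← hB t ht] at hy
    exact hy
  have hG' : ∀ t ∈ pointSpectrum A \ B, ∀ y ∈ realEigenspace A t,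
      ∃ z ∈ realEigenspace A t, (T.symm : H →ₗ[𝕜] H) z = y := by
    intro t ht y hy
    refine ⟨T y, ?_, T.symm_apply_apply y⟩
    rw [← hB t ht]
    exact Submodule.mem_map_of_mem hy
  have hmax : ∀ m, IsGreatest B m →
      (realEigenspace A m).map (T : H →ₗ[𝕜] H) ≤ realEigenspace A m := by
    rintro m ⟨hm, hub⟩ _ ⟨y, hy, rfl⟩
    refine form_preserving_extreme_eigenspace (e := 1) hA htotal h0 hT hG hm
      (fun t ht => by linarith [hub ht]) (fun z => ?_) one_ne_zero hy
    have := h0 m hm.1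
    have := hcontr z
    simp only [LinearEquiv.coe_coe]
    gcongr
  -- The inverse of `T` preserves the form and does not shrink norms; the sign `e = -1` adapts both
  -- inequalities.
  have hmin : ∀ m, IsLeast B m →
      realEigenspace A m ≤ (realEigenspace A m).map (T : H →ₗ[𝕜] H) := by
    rintro m ⟨hm, hlb⟩ y hy
    refine ⟨T.symm y, ?_, T.apply_symm_apply y⟩
    refine form_preserving_extreme_eigenspace (S := (T.symm : H →ₗ[𝕜] H)) (e := -1) hA htotal h0
      hTsymm hG' hm (fun t ht => by linarith [hlb ht]) (fun z => ?_) (by norm_num) hy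
    have h1 := h0 m hm.1
    have h2 := hcontr (T.symm z)
    rw [T.apply_symm_apply] at h2
    have h3 : m * ‖z‖ ^ 2 ≤ m * ‖T.symm z‖ ^ 2 := by gcongr
    simp only [LinearEquiv.coe_coe]
    linarith
  have hBempty : B = ∅ := by
    rcases B.subsingleton_or_nontrivial with hs | hn
    · rcases hs.eq_empty_or_singleton with h | ⟨m, h⟩
      · exact h
      · have hmB : m ∈ B := h ▸ rfl
        refine absurd (le_antisymm (hmax m ?_) (hmin m ?_)) hmB.2
        · rw [h]; exact isGreatest_singleton
        · rw [h]; exact isLeast_singleton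
    -- Since `T` is injective, an inclusion between a finite-dimensional eigenspace and its image is
    -- an equality.
    · have hdim : ∀ m, Module.finrank 𝕜 ((realEigenspace A m).map (T : H →ₗ[𝕜] H)) =
          Module.finrank 𝕜 (realEigenspace A m) := fun m => T.finrank_map_eq _
      rcases hext B (fun t ht => ht.1) hn with ⟨m, hm, hfin⟩ | ⟨m, hm, hfin⟩
      · have : FiniteDimensional 𝕜 (realEigenspace A m) := hfin
        exact absurd (Submodule.eq_of_le_of_finrank_eq (hmax m hm) (hdim m)) hm.1.2
      · have : FiniteDimensional 𝕜 (realEigenspace A m) := hfin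
        exact absurd (Submodule.eq_of_le_of_finrank_eq (hmin m hm) (hdim m).symm).symm hm.1.2
  let Tc : H →L[𝕜] H := (T : H →ₗ[𝕜] H).mkContinuous 1 fun x => by simpa using hcontr x
  have hTc : ∀ y, Tc y = T y := fun y => rfl
  -- For `y` in the eigenspace of `t`, so is `T y`, and preservation of the form becomes `t ⟨Ty, Tz⟩
  -- = t ⟨y, z⟩`. Hence `T*T - 1` kills all eigenvectors.
  let D : H →L[𝕜] H := ContinuousLinearMap.adjoint Tc ∘L Tc - 1
  have hD : ∀ y z, inner 𝕜 (D y) z = inner 𝕜 (T y) (T z) - inner 𝕜 y z := by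
    intro y z
    have : D y = ContinuousLinearMap.adjoint Tc (Tc y) - y := rfl
    rw [this, inner_sub_left, ContinuousLinearMap.adjoint_inner_left, hTc, hTc]
  have hDeig : ∀ t, realEigenspace A t ≤ (D : H →ₗ[𝕜] H).ker := by
    intro t y hy
    rw [LinearMap.mem_ker]
    by_cases ht : t ∈ pointSpectrum A
    · have hTy : T y ∈ realEigenspace A t := by
        rw [← hB t ⟨ht, by simp [hBempty]⟩]
        exact Submodule.mem_map_of_mem hy
      refine ext_inner_right 𝕜 fun z => ?_
      rw [ContinuousLinearMap.coe_coe, hD, inner_zero_left, sub_eq_zero]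
      have h := hT y z
      rw [mem_realEigenspace.1 hTy, mem_realEigenspace.1 hy, inner_smul_left,
        inner_smul_left] at h
      refine mul_left_cancel₀ ?_ h
      rw [RCLike.conj_ofReal]
      exact_mod_cast (h0 t ht).ne'
    · rw [realEigenspace_eq_bot ht, Submodule.mem_bot] at hy
      rw [hy, map_zero]
  have hx : D x = 0 := by
    have hle : (⨆ t : (Set.univ : Set ℝ), realEigenspace A t).topologicalClosure ≤
        (D : H →ₗ[𝕜] H).ker :=
      Submodule.topologicalClosure_minimal _ (iSup_le fun t => hDeig t) D.isClosed_ker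
    exact hle (mem_closure_iSup_realEigenspace hA htotal fun t ht => absurd trivial ht.2)
  have h1 := hD x x
  rw [hx, inner_zero_left, eq_comm, sub_eq_zero, inner_self_eq_norm_sq_to_K,
    inner_self_eq_norm_sq_to_K] at h1
  have h2 : ‖T x‖ ^ 2 = ‖x‖ ^ 2 := by exact_mod_cast h1
  exact (sq_eq_sq₀ (norm_nonneg _) (norm_nonneg _)).1 h2

end Rigidity

/-! ### From maps of the ellipsoid to operators on the space; sufficiency. -/

section Ellipsoids

variable {𝕜 H : Type*} [RCLike 𝕜] [NormedAddCommGroup H] [InnerProductSpace 𝕜 H]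

theorem re_inner_smul_apply (A : H →L[𝕜] H) (s : ℝ) (x : H) :
    RCLike.re (inner 𝕜 ((s : 𝕜) • x) (A ((s : 𝕜) • x))) =
      s ^ 2 * RCLike.re (inner 𝕜 x (A x)) := by
  rw [map_smul, inner_smul_left, inner_smul_right, RCLike.conj_ofReal, RCLike.re_ofReal_mul,
    RCLike.re_ofReal_mul]
  ring

theorem mem_ellipsoid {A : H →L[𝕜] H} {x : H} :
    x ∈ ellipsoid A ↔ RCLike.re (inner 𝕜 x (A x)) ≤ 1 := Iff.rfl

/-- The ellipsoid is absorbing, so linear facts known on it pass to all of `H`. -/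
theorem exists_smul_mem_ellipsoid (A : H →L[𝕜] H) (x : H) :
    ∃ s : ℝ, 0 < s ∧ (s : 𝕜) • x ∈ ellipsoid A := by
  set q := RCLike.re (inner 𝕜 x (A x)) with hq
  have h1 : 0 < 1 + |q| := by positivity
  refine ⟨(1 + |q|)⁻¹, by positivity, ?_⟩
  rw [mem_ellipsoid, re_inner_smul_apply, ← hq, inv_pow, inv_mul_le_iff₀ (by positivity)]
  nlinarith [le_abs_self q, abs_nonneg q]

theorem coercive_of_unit {A : H →L[𝕜] H} {c : ℝ}
    (hc : ∀ x : H, ‖x‖ = 1 → c ≤ RCLike.re (inner 𝕜 (A x) x)) (x : H) :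
    c * ‖x‖ ^ 2 ≤ RCLike.re (inner 𝕜 (A x) x) := by
  by_cases hx : x = 0
  · simp [hx]
  have hx' : 0 < ‖x‖ := norm_pos_iff.2 hx
  have h := hc (((‖x‖⁻¹ : ℝ) : 𝕜) • x) (by
    rw [norm_smul, RCLike.norm_ofReal, abs_of_pos (by positivity), inv_mul_cancel₀ hx'.ne'])
  rw [map_smul, inner_smul_left, inner_smul_right, RCLike.conj_ofReal, RCLike.re_ofReal_mul,
    RCLike.re_ofReal_mul, ← mul_assoc, ← mul_inv, ← sq, le_inv_mul_iff₀ (by positivity)] at h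
  linarith

/-- By coercivity a nonzero `x` can be rescaled to the boundary of the ellipsoid, and the form is
homogeneous of degree two. -/
theorem re_inner_apply_le_of_mapsTo {A : H →L[𝕜] H} {c : ℝ} (hc0 : 0 < c)
    (hc : ∀ x : H, c * ‖x‖ ^ 2 ≤ RCLike.re (inner 𝕜 x (A x))) {S : H →ₗ[𝕜] H}
    (hS : Set.MapsTo S (ellipsoid A) (ellipsoid A)) (x : H) :
    RCLike.re (inner 𝕜 (S x) (A (S x))) ≤ RCLike.re (inner 𝕜 x (A x)) := by
  by_cases hx : x = 0
  · simp [hx]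
  have hx' : 0 < ‖x‖ := norm_pos_iff.2 hx
  set q := RCLike.re (inner 𝕜 x (A x)) with hq
  have hq0 : 0 < q := lt_of_lt_of_le (by positivity) (hc x)
  have hmem : (((√q)⁻¹ : ℝ) : 𝕜) • x ∈ ellipsoid A := by
    rw [mem_ellipsoid, re_inner_smul_apply, ← hq, inv_pow, Real.sq_sqrt hq0.le,
      inv_mul_cancel₀ hq0.ne']
  have h := hS hmem
  rwa [map_smul, mem_ellipsoid, re_inner_smul_apply, inv_pow, Real.sq_sqrt hq0.le,
    inv_mul_le_iff₀ hq0, mul_one] at h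

theorem pointSpectrum_pos {A : H →L[𝕜] H} {c : ℝ} (hc0 : 0 < c)
    (hc : ∀ x : H, c * ‖x‖ ^ 2 ≤ RCLike.re (inner 𝕜 x (A x))) {t : ℝ} (ht : t ∈ pointSpectrum A) :
    0 < t := by
  obtain ⟨v, hv, hv0⟩ := Module.End.HasEigenvalue.exists_hasEigenvector ht
  have hv' : 0 < ‖v‖ := norm_pos_iff.2 hv0
  have h := hc v
  rw [mem_realEigenspace.1 hv, inner_smul_right, RCLike.re_ofReal_mul, inner_self_eq_norm_sq] at h
  have : 0 < ‖v‖ ^ 2 := by positivity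
  nlinarith

variable [CompleteSpace H]

/-- A linear operator that maps the ellipsoid of `A` bijectively and without expansion onto itself
is a bijective contraction of the space preserving the form of `A`. -/
theorem exists_equiv_of_bijOn_ellipsoid {A : H →L[𝕜] H} (hA : IsSelfAdjoint A) {c : ℝ} (hc0 : 0 < c)
    (hc : ∀ x : H, c * ‖x‖ ^ 2 ≤ RCLike.re (inner 𝕜 x (A x))) {T : H →ₗ[𝕜] H}
    (hT : Set.BijOn T (ellipsoid A) (ellipsoid A))
    (hcontr : ∀ x ∈ ellipsoid A, ∀ y ∈ ellipsoid A, dist (T x) (T y) ≤ dist x y) :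
    ∃ T' : H ≃ₗ[𝕜] H, (∀ x, T' x = T x) ∧ (∀ x, ‖T x‖ ≤ ‖x‖) ∧
      ∀ x y, inner 𝕜 (A (T x)) (T y) = inner 𝕜 (A x) y := by
  have h0E : (0 : H) ∈ ellipsoid A := by simp [mem_ellipsoid]
  have hinj : Function.Injective T := by
    refine (injective_iff_map_eq_zero T).2 fun x hx => ?_
    obtain ⟨s, hs, hsx⟩ := exists_smul_mem_ellipsoid A x
    have h : (s : 𝕜) • x = 0 := hT.injOn hsx h0E (by rw [map_smul, hx, smul_zero, map_zero])
    rcases smul_eq_zero.1 h with h | h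
    · exact absurd (by exact_mod_cast h) hs.ne'
    · exact h
  have hsurj : Function.Surjective T := by
    intro y
    obtain ⟨s, hs, hsy⟩ := exists_smul_mem_ellipsoid A y
    obtain ⟨x, -, hx⟩ := hT.surjOn hsy
    refine ⟨((s : 𝕜)⁻¹) • x, ?_⟩
    rw [map_smul, hx, smul_smul, inv_mul_cancel₀ (by exact_mod_cast hs.ne'), one_smul]
  have hnorm : ∀ x, ‖T x‖ ≤ ‖x‖ := by
    intro x
    obtain ⟨s, hs, hsx⟩ := exists_smul_mem_ellipsoid A x
    have h := hcontr _ hsx _ h0E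
    rw [map_zero, dist_zero_right, dist_zero_right, map_smul, norm_smul, norm_smul,
      RCLike.norm_ofReal, abs_of_pos hs] at h
    exact le_of_mul_le_mul_left h hs
  let T' : H ≃ₗ[𝕜] H := LinearEquiv.ofBijective T ⟨hinj, hsurj⟩
  have hT' : ∀ x, T' x = T x := fun x => rfl
  refine ⟨T', hT', hnorm, ?_⟩
  have hsymm : Set.MapsTo (T'.symm : H →ₗ[𝕜] H) (ellipsoid A) (ellipsoid A) := by
    intro y hy
    obtain ⟨x, hx, rfl⟩ := hT.surjOn hy
    have : T'.symm (T x) = x := T'.symm_apply_apply x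
    rw [LinearEquiv.coe_coe, this]
    exact hx
  have hform : ∀ x, RCLike.re (inner 𝕜 (T x) (A (T x))) = RCLike.re (inner 𝕜 x (A x)) := by
    intro x
    refine le_antisymm (re_inner_apply_le_of_mapsTo hc0 hc hT.mapsTo x) ?_
    have h := re_inner_apply_le_of_mapsTo hc0 hc hsymm (T x)
    have hx : T'.symm (T x) = x := T'.symm_apply_apply x
    rwa [LinearEquiv.coe_coe, hx] at h
  let Tc : H →L[𝕜] H := T.mkContinuous 1 fun x => by simpa using hnorm x
  have hTc : ∀ y, Tc y = T y := fun y => rfl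
  -- The self-adjoint operator `T*AT - A` has zero quadratic form, hence vanishes; this replaces
  -- polarization over both fields.
  let D : H →L[𝕜] H := ContinuousLinearMap.adjoint Tc ∘L A ∘L Tc - A
  have hDx : ∀ y, D y = ContinuousLinearMap.adjoint Tc (A (T y)) - A y := fun y => rfl
  have hsA : ∀ x y, inner 𝕜 (A x) y = inner 𝕜 x (A y) := hA.isSymmetric
  have hD : ∀ y z, inner 𝕜 (D y) z = inner 𝕜 (A (T y)) (T z) - inner 𝕜 (A y) z := by
    intro y z
    rw [hDx, inner_sub_left, ContinuousLinearMap.adjoint_inner_left, hTc]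
  have hD' : ∀ y z, inner 𝕜 y (D z) = inner 𝕜 (T y) (A (T z)) - inner 𝕜 y (A z) := by
    intro y z
    rw [hDx, inner_sub_right, ContinuousLinearMap.adjoint_inner_right, hTc]
  have hD0 : ∀ x, RCLike.re (inner 𝕜 x (D x)) = 0 := by
    intro x
    rw [hD', map_sub, hform, sub_self]
  intro x y
  have h := apply_eq_zero_of_re_inner_eq_zero (S := D) (L := ⊤)
    (fun y z => by rw [hD, hD', hsA, hsA]) (fun _ _ => trivial) (fun x _ => (hD0 x).ge)
    (x := x) trivial (hD0 x).le
  have h2 := hD x y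
  rw [h, inner_zero_left] at h2
  exact (sub_eq_zero.1 h2.symm)

/-- A nonzero symmetric operator space has spectrum by `exists_mem_spectrum_abs_eq_norm`, which
needs no closedness of `H_cont`. On the zero space every operator is invertible. -/
theorem contSpectrum_eq_empty_iff {A : H →L[𝕜] H} (hA : IsSelfAdjoint A) :
    contSpectrum A hA = ∅ ↔ contSubspace A = ⊥ := by
  constructor
  · intro h
    by_contra hne
    have : Nontrivial (contSubspace A) := Submodule.nontrivial_iff_ne_bot.2 hne
    obtain ⟨t, -, ht⟩ := exists_mem_spectrum_abs_eq_norm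
      (A.restrict (contSubspace_invariant hA)) fun x y => hA.isSymmetric (x : H) (y : H)
    have ht' : (t : 𝕜) ∈ contSpectrum A hA := ht
    rw [h] at ht'
    exact ht'
  · intro h
    have : Subsingleton (contSubspace A) := Submodule.subsingleton_iff_eq_bot.2 h
    have : Subsingleton (contSubspace A →L[𝕜] contSubspace A) :=
      ⟨fun S T => ContinuousLinearMap.ext fun x => Subsingleton.elim _ _⟩
    exact spectrum.of_subsingleton _

theorem isLECPlastic_of_conditions [Nontrivial H] {A : H →L[𝕜] H} (hA : IsSelfAdjoint A) {c : ℝ}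
    (hc0 : 0 < c) (hc : ∀ x : H, c * ‖x‖ ^ 2 ≤ RCLike.re (inner 𝕜 x (A x)))
    (hcont : contSubspace A = ⊥)
    (hext : ∀ B : Set ℝ, B ⊆ pointSpectrum A → B.Nontrivial →
        (∃ m, IsGreatest B m ∧ HasFiniteMultiplicity A m) ∨
        (∃ m, IsLeast B m ∧ HasFiniteMultiplicity A m)) :
    IsLECPlastic 𝕜 (ellipsoid A) := by
  intro T hT hcontr x _ y _
  obtain ⟨T', hT', hnorm, hform⟩ := exists_equiv_of_bijOn_ellipsoid hA hc0 hc hT hcontr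
  simp only [← hT'] at hnorm hform
  rw [dist_eq_norm, dist_eq_norm, ← map_sub, ← hT']
  exact norm_eq_of_form_preserving hA.isSymmetric
    (fun x hx => eq_zero_of_contSubspace_eq_bot hA hcont fun t v hv =>
      hx t v (mem_realEigenspace.2 hv))
    (fun t ht => pointSpectrum_pos hc0 hc ht) hext hform hnorm _

end Ellipsoids

/-! ### Shift unitaries that destroy plasticity. -/

section Shifts

variable {𝕜 H : Type*} [RCLike 𝕜] [NormedAddCommGroup H] [InnerProductSpace 𝕜 H]

/-- If `R ^ 2 = A` in the sense of forms, `Q` is inverse to `R`, and a unitary operator shrinks the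
norm `‖Q x‖`, then in case of plasticity it preserves this norm. -/
theorem IsLECPlastic.norm_eq_of_unitary {A Q R : H →L[𝕜] H} (hE : IsLECPlastic 𝕜 (ellipsoid A))
    (hR : ∀ x, RCLike.re (inner 𝕜 x (A x)) = ‖R x‖ ^ 2) (hRQ : ∀ x, R (Q x) = x)
    (hQR : ∀ x, Q (R x) = x) {U : H ≃ₗᵢ[𝕜] H} (hU : ∀ x, ‖Q (U x)‖ ≤ ‖Q x‖) (x : H) :
    ‖Q (U x)‖ = ‖Q x‖ := by
  -- Here `‖R(Tx)‖ = ‖Rx‖` and `Q U⁻¹ R` is the inverse, so `T` permutes the ellipsoid; moreover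
  -- `‖Tx‖ ≤ ‖Q(Rx)‖ = ‖x‖`.
  let T : H →ₗ[𝕜] H := (Q : H →ₗ[𝕜] H) ∘ₗ (U.toLinearEquiv : H →ₗ[𝕜] H) ∘ₗ (R : H →ₗ[𝕜] H)
  have hT : ∀ x, T x = Q (U (R x)) := fun x => rfl
  have hmem : ∀ x, x ∈ ellipsoid A ↔ ‖R x‖ ^ 2 ≤ 1 := fun x => by rw [mem_ellipsoid, hR]
  have h := hE T ⟨fun x hx => ?_, fun x _ y _ hxy => ?_, fun y hy => ?_⟩ fun x _ y _ => ?_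
  · obtain ⟨s, hs, hsx⟩ := exists_smul_mem_ellipsoid A (Q x)
    have h1 := h _ hsx 0 (by simp [mem_ellipsoid])
    rw [map_zero, dist_zero_right, dist_zero_right, map_smul, norm_smul, norm_smul,
      RCLike.norm_ofReal, abs_of_pos hs, hT, hRQ] at h1
    exact mul_left_cancel₀ hs.ne' h1
  · rw [hmem] at hx ⊢
    rwa [hT, hRQ, U.norm_map]
  · rw [hT, hT] at hxy
    have h1 := congrArg R hxy
    rw [hRQ, hRQ] at h1
    rw [← hQR x, ← hQR y, U.injective h1]
  · refine ⟨Q (U.symm (R y)), ?_, ?_⟩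
    · rw [hmem] at hy ⊢
      rwa [hRQ, U.symm.norm_map]
    · rw [hT, hRQ, U.apply_symm_apply, hQR]
  · rw [dist_eq_norm, dist_eq_norm, ← map_sub, hT]
    exact (hU _).trans_eq (by rw [hQR])

variable [CompleteSpace H]

/-- A permutation of a Hilbert basis induces a unitary operator. -/
theorem HilbertBasis.exists_unitary_of_perm {ι : Type*} (b : HilbertBasis ι 𝕜 H)
    (π : Equiv.Perm ι) : ∃ U : H ≃ₗᵢ[𝕜] H, (∀ j, U (b j) = b (π j)) ∧
      ∀ j x, inner 𝕜 (b (π j)) (U x) = inner 𝕜 (b j) x := by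
  classical
  have hrange : Set.range (b ∘ π) = Set.range b := π.surjective.range_comp b
  let c : HilbertBasis ι 𝕜 H := HilbertBasis.mk (b.orthonormal.comp π π.injective) (by
    rw [hrange, b.dense_span])
  have hc : ∀ j, c j = b (π j) := fun j => by
    simp only [c, HilbertBasis.coe_mk, Function.comp_apply]
  refine ⟨b.repr.trans c.repr.symm, fun j => ?_, fun j x => ?_⟩
  · rw [LinearIsometryEquiv.trans_apply, HilbertBasis.repr_self, HilbertBasis.repr_symm_single, hc]
  · rw [← hc, ← HilbertBasis.repr_apply_apply, LinearIsometryEquiv.trans_apply,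
      LinearIsometryEquiv.apply_symm_apply, HilbertBasis.repr_apply_apply]

variable {G : Type*} [NormedAddCommGroup G] [InnerProductSpace 𝕜 G]

/-- The bilateral shift along a family of pairwise orthogonal copies of `G`, extended by the
identity. -/
theorem exists_shift_unitary [CompleteSpace G] (w : ℤ → G →ₗᵢ[𝕜] H)
    (hw : ∀ j k, j ≠ k → ∀ g g', inner 𝕜 (w j g) (w k g') = 0) :
    ∃ U : H ≃ₗᵢ[𝕜] H, (∀ k g, U (w k g) = w (k + 1) g) ∧
      ∀ x, (∀ k g, inner 𝕜 (w k g) x = 0) → U x = x := by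
  obtain ⟨s, b, -⟩ := exists_hilbertBasis 𝕜 G
  let e : ℤ × s → H := fun p => w p.1 (b p.2)
  have he : Orthonormal 𝕜 e := by
    refine ⟨fun p => ?_, fun p q hpq => ?_⟩
    · rw [(w p.1).norm_map, b.orthonormal.1]
    · by_cases h : p.1 = q.1
      · have h2 : p.2 ≠ q.2 := fun h2 => hpq (Prod.ext h h2)
        simp only [e]
        rw [h, (w q.1).inner_map_map, b.orthonormal.2 h2]
      · exact hw _ _ h _ _
  obtain ⟨W, B, hsub, hB⟩ := he.toSubtypeRange.exists_hilbertBasis_extension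
  let ι : ℤ × s ↪ W := ⟨fun p => ⟨e p, hsub ⟨p, rfl⟩⟩, fun p q h =>
    he.linearIndependent.injective (congrArg Subtype.val h)⟩
  have hBι : ∀ p, B (ι p) = e p := fun p => by rw [hB]; rfl
  -- The shift permutes the basis vectors of the copies and fixes the remaining vectors of the
  -- extended basis.
  let σ : Equiv.Perm (ℤ × s) := (Equiv.addRight (1 : ℤ)).prodCongr (Equiv.refl s)
  obtain ⟨U, hU, hU'⟩ := B.exists_unitary_of_perm (σ.viaEmbedding ι)
  have hUe : ∀ k i, U (w k (b i)) = w (k + 1) (b i) := by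
    intro k i
    have h := hU (ι (k, i))
    rw [Equiv.Perm.viaEmbedding_apply, hBι, hBι] at h
    exact h
  refine ⟨U, fun k g => ?_, fun x hx => ?_⟩
  · have h : (U.toContinuousLinearEquiv : H →L[𝕜] H) ∘L (w k).toContinuousLinearMap =
        (w (k + 1)).toContinuousLinearMap := by
      refine ContinuousLinearMap.ext_on (s := Set.range b) ?_ ?_
      · exact Submodule.dense_iff_topologicalClosure_eq_top.2 b.dense_span
      · rintro _ ⟨i, rfl⟩
        exact hUe k i
    exact congrArg (fun L : G →L[𝕜] H => L g) h
  · refine B.repr.injective (lp.ext (funext fun j => ?_))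
    rw [HilbertBasis.repr_apply_apply, HilbertBasis.repr_apply_apply]
    obtain ⟨i, rfl⟩ := (σ.viaEmbedding ι).surjective j
    rw [hU']
    by_cases hi : i ∈ Set.range ι
    · obtain ⟨p, rfl⟩ := hi
      rw [Equiv.Perm.viaEmbedding_apply, hBι, hBι]
      exact (hx _ _).trans (hx _ _).symm
    · rw [Equiv.Perm.viaEmbedding_apply_of_notMem _ _ _ hi]

/-- The operator `Q² - U⁻¹Q²U` has form `‖Qx‖² - ‖QUx‖²` and is block diagonal for the copies and
their common complement, so it suffices to check the sign on each block. -/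
theorem norm_apply_shift_le {Q : H →L[𝕜] H} (hQ : IsSelfAdjoint Q) {w : ℤ → G →ₗᵢ[𝕜] H}
    (hw : ∀ j k, j ≠ k → ∀ g g', inner 𝕜 (w j g) (w k g') = 0)
    (hQw : ∀ k g, ∃ g', Q (w k g) = w k g') (hle : ∀ k g, ‖Q (w (k + 1) g)‖ ≤ ‖Q (w k g)‖)
    {U : H ≃ₗᵢ[𝕜] H} (hU : ∀ k g, U (w k g) = w (k + 1) g)
    (hU' : ∀ x, (∀ k g, inner 𝕜 (w k g) x = 0) → U x = x) (x : H) : ‖Q (U x)‖ ≤ ‖Q x‖ := by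
  let N : Submodule 𝕜 H := (⨆ k, (w k).toLinearMap.range)ᗮ
  have hN : ∀ x, x ∈ N ↔ ∀ k g, inner 𝕜 (w k g) x = 0 := by
    intro x
    simp only [N, ← Submodule.iInf_orthogonal, Submodule.mem_iInf, Submodule.mem_orthogonal]
    exact ⟨fun h k g => h k _ ⟨g, rfl⟩, by rintro h k _ ⟨g, rfl⟩; exact h k g⟩
  let V : Option ℤ → Submodule 𝕜 H := fun o => o.elim N fun k => (w k).toLinearMap.range
  have hQs : ∀ x y, inner 𝕜 (Q x) y = inner 𝕜 x (Q y) := hQ.isSymmetric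
  have hQN : ∀ x ∈ N, Q x ∈ N := by
    intro x hx
    rw [hN] at hx ⊢
    intro k g
    obtain ⟨g', hg'⟩ := hQw k g
    rw [← hQs, hg', hx]
  have hUs : ∀ k g, U.symm (w (k + 1) g) = w k g := fun k g => by
    rw [← hU, U.symm_apply_apply]
  let S : H →L[𝕜] H := Q ∘L Q - (U.symm.toContinuousLinearEquiv : H →L[𝕜] H) ∘L Q ∘L Q ∘L
    (U.toContinuousLinearEquiv : H →L[𝕜] H)
  have hS : ∀ x, S x = Q (Q x) - U.symm (Q (Q (U x))) := fun x => rfl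
  have hSform : ∀ x, RCLike.re (inner 𝕜 x (S x)) = ‖Q x‖ ^ 2 - ‖Q (U x)‖ ^ 2 := by
    intro x
    have h1 : inner 𝕜 x (U.symm (Q (Q (U x)))) = inner 𝕜 (Q (U x)) (Q (U x)) := by
      rw [← U.inner_map_map, U.apply_symm_apply, hQs]
    rw [hS, inner_sub_right, h1, ← hQs, map_sub, inner_self_eq_norm_sq, inner_self_eq_norm_sq]
  have hSV : ∀ o, ∀ x ∈ V o, S x ∈ V o := by
    rintro (_ | k) x hx
    · have hx' : x ∈ N := hx
      have hux : U x = x := hU' x ((hN x).1 hx')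
      have hq : Q (Q x) ∈ N := hQN _ (hQN _ hx')
      have hq' : U.symm (Q (Q x)) = Q (Q x) := by
        rw [LinearIsometryEquiv.symm_apply_eq, hU' _ ((hN _).1 hq)]
      rw [hS, hux, hq', sub_self]
      exact Submodule.zero_mem _
    · obtain ⟨g, rfl⟩ := hx
      obtain ⟨g1, h1⟩ := hQw k g
      obtain ⟨g2, h2⟩ := hQw k g1
      obtain ⟨g3, h3⟩ := hQw (k + 1) g
      obtain ⟨g4, h4⟩ := hQw (k + 1) g3
      refine ⟨g2 - g4, ?_⟩
      simp only [LinearIsometry.coe_toLinearMap]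
      rw [hS, h1, h2, hU, h3, h4, hUs, map_sub]
  have hpos : ∀ o, ∀ x ∈ V o, 0 ≤ RCLike.re (inner 𝕜 x (S x)) := by
    rintro (_ | k) x hx
    · rw [hSform, hU' x ((hN x).1 hx), sub_self]
    · obtain ⟨g, rfl⟩ := hx
      simp only [LinearIsometry.coe_toLinearMap]
      rw [hSform, hU, sub_nonneg]
      gcongr
      exact hle k g
  have horth : ∀ o p, o ≠ p → ∀ x ∈ V o, ∀ y ∈ V p, inner 𝕜 x y = 0 := by
    rintro (_ | j) (_ | k) hne x hx y hy
    · exact absurd rfl hne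
    · obtain ⟨g, rfl⟩ := hy
      rw [← inner_conj_symm]
      exact (congrArg _ ((hN x).1 hx k g)).trans (map_zero _)
    · obtain ⟨g, rfl⟩ := hx
      exact (hN y).1 hy j g
    · obtain ⟨g, rfl⟩ := hx
      obtain ⟨g', rfl⟩ := hy
      exact hw j k (fun h => hne (congrArg some h)) g g'
  have hdense : (⨆ o, V o).topologicalClosure = ⊤ := by
    rw [Submodule.topologicalClosure_eq_top_iff, Submodule.eq_bot_iff]
    intro y hy
    have hyN : y ∈ N := (hN y).2 fun k g =>
      hy _ ((le_iSup V (some k)) ⟨g, rfl⟩)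
    exact inner_self_eq_zero.1 (hy y ((le_iSup V none) hyN))
  have h := re_inner_nonneg_of_orthogonal horth S hSV hpos (x := x) (by rw [hdense]; trivial)
  rw [hSform, sub_nonneg] at h
  exact (sq_le_sq₀ (norm_nonneg _) (norm_nonneg _)).1 h

theorem not_isLECPlastic_of_shift [CompleteSpace G] {A Q R : H →L[𝕜] H} (hQ : IsSelfAdjoint Q)
    (hR : ∀ x, RCLike.re (inner 𝕜 x (A x)) = ‖R x‖ ^ 2) (hRQ : ∀ x, R (Q x) = x)
    (hQR : ∀ x, Q (R x) = x) {w : ℤ → G →ₗᵢ[𝕜] H}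
    (hw : ∀ j k, j ≠ k → ∀ g g', inner 𝕜 (w j g) (w k g') = 0)
    (hQw : ∀ k g, ∃ g', Q (w k g) = w k g') (hle : ∀ k g, ‖Q (w (k + 1) g)‖ ≤ ‖Q (w k g)‖)
    (hlt : ∃ k g, ‖Q (w (k + 1) g)‖ < ‖Q (w k g)‖) : ¬ IsLECPlastic 𝕜 (ellipsoid A) := by
  intro hE
  obtain ⟨U, hU, hU'⟩ := exists_shift_unitary w hw
  obtain ⟨k, g, hkg⟩ := hlt
  have h := hE.norm_eq_of_unitary hR hRQ hQR (norm_apply_shift_le hQ hw hQw hle hU hU') (w k g)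
  rw [hU] at h
  exact hkg.ne h

end Shifts

/-! ### Square roots of the operator. -/

section SquareRoots

variable {𝕜 H : Type*} [RCLike 𝕜] [NormedAddCommGroup H] [InnerProductSpace 𝕜 H] [CompleteSpace H]

/-- For `t < c` the form of `A - t` is bounded below by `c - t`, so `A - t` is invertible. -/
theorem le_of_mem_realSpectrum {A : H →L[𝕜] H} {c : ℝ}
    (hc : ∀ x : H, c * ‖x‖ ^ 2 ≤ RCLike.re (inner 𝕜 x (A x))) {t : ℝ} (ht : t ∈ realSpectrum A) :
    c ≤ t := by
  by_contra! hlt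
  refine spectrum.mem_iff.1 ht ?_
  rw [← neg_sub, IsUnit.neg_iff]
  have hd : 0 < c - t := sub_pos.2 hlt
  obtain ⟨d, hd'⟩ : ∃ d : NNReal, (d : ℝ) = c - t := ⟨⟨c - t, hd.le⟩, rfl⟩
  refine ContinuousLinearMap.isUnit_of_forall_le_norm_inner_map _ (c := d)
    (NNReal.coe_pos.1 (hd' ▸ hd)) fun x => ?_
  rw [norm_inner_symm]
  refine le_trans ?_ (RCLike.re_le_norm _)
  have h1 : algebraMap 𝕜 (H →L[𝕜] H) (t : 𝕜) x = (t : 𝕜) • x := rfl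
  rw [sub_apply, h1, inner_sub_right, inner_smul_right, map_sub, RCLike.re_ofReal_mul,
    inner_self_eq_norm_sq, hd']
  linarith [hc x]

/-- The function `t ↦ t⁻¹ᐟ²` on the spectrum and its inverse. -/
theorem exists_inv_sqrt [Nontrivial H] {A : H →L[𝕜] H} (hA : IsSelfAdjoint A) {c : ℝ} (hc0 : 0 < c)
    (hc : ∀ x : H, c * ‖x‖ ^ 2 ≤ RCLike.re (inner 𝕜 x (A x))) :
    ∃ q r : C(realSpectrum A, ℝ), (∀ t, q t = (√t)⁻¹) ∧ q * r = 1 ∧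
      ∀ x, RCLike.re (inner 𝕜 x (A x)) = ‖contCalc A r x‖ ^ 2 := by
  have hpos : ∀ t : realSpectrum A, 0 < (t : ℝ) := fun t =>
    hc0.trans_le (le_of_mem_realSpectrum hc t.2)
  have hsq : ∀ t : realSpectrum A, 0 < √(t : ℝ) := fun t => Real.sqrt_pos.2 (hpos t)
  let r : C(realSpectrum A, ℝ) := ⟨fun t => √t, by fun_prop⟩
  let q : C(realSpectrum A, ℝ) := ⟨fun t => (√t)⁻¹,
    (show Continuous fun t : realSpectrum A => √(t : ℝ) by fun_prop).inv₀ fun t => (hsq t).ne'⟩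
  refine ⟨q, r, fun t => rfl, ?_, fun x => ?_⟩
  · ext t
    exact inv_mul_cancel₀ (hsq t).ne'
  · rw [norm_contCalc_apply_sq hA]
    have : r * r = polyOnSpectrum A X := by
      ext t
      rw [polyOnSpectrum_apply, eval_X]
      exact Real.mul_self_sqrt (hpos t).le
    rw [this, contCalc_X hA]

theorem not_isLECPlastic_of_contCalc_shift [Nontrivial H] {A : H →L[𝕜] H} (hA : IsSelfAdjoint A)
    {q r : C(realSpectrum A, ℝ)} (hqr : q * r = 1)
    (hr : ∀ x, RCLike.re (inner 𝕜 x (A x)) = ‖contCalc A r x‖ ^ 2)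
    {G : Type*} [NormedAddCommGroup G] [InnerProductSpace 𝕜 G] [CompleteSpace G]
    {w : ℤ → G →ₗᵢ[𝕜] H}
    (hw : ∀ j k, j ≠ k → ∀ g g', inner 𝕜 (w j g) (w k g') = 0)
    (hQw : ∀ k g, ∃ g', contCalc A q (w k g) = w k g')
    (hle : ∀ k g, ‖contCalc A q (w (k + 1) g)‖ ≤ ‖contCalc A q (w k g)‖)
    (hlt : ∃ k g, ‖contCalc A q (w (k + 1) g)‖ < ‖contCalc A q (w k g)‖) :
    ¬ IsLECPlastic 𝕜 (ellipsoid A) := by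
  refine not_isLECPlastic_of_shift (isSelfAdjoint_contCalc hA q) hr (fun x => ?_) (fun x => ?_)
    hw hQw hle hlt
  · rw [← contCalc_mul_apply hA, mul_comm, hqr, contCalc_one hA]; rfl
  · rw [← contCalc_mul_apply hA, hqr, contCalc_one hA]; rfl

end SquareRoots

/-! ### Failure of plasticity from eigenvalues. -/

section EigenvectorSequences

variable {𝕜 H : Type*} [RCLike 𝕜] [NormedAddCommGroup H] [InnerProductSpace 𝕜 H]

theorem exists_orthonormal_nat (hH : ¬ FiniteDimensional 𝕜 H) : ∃ f : ℕ → H, Orthonormal 𝕜 f := by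
  let b := Module.Basis.ofVectorSpace 𝕜 H
  have : Infinite (Module.Basis.ofVectorSpaceIndex 𝕜 H) := by
    by_contra h
    rw [not_infinite_iff_finite] at h
    exact hH (Module.Finite.of_basis b)
  exact ⟨_, InnerProductSpace.gramSchmidtNormed_orthonormal
    (b.linearIndependent.comp _ (Infinite.natEmbedding _).injective)⟩

/-- An increasing sequence of parameters with orthonormal vectors in the corresponding subspaces. -/
theorem exists_monotone_orthonormal {K : ℝ → Submodule 𝕜 H}
    (horth : ∀ s t, s ≠ t → ∀ x ∈ K s, ∀ y ∈ K t, inner 𝕜 x y = 0) {B : Set ℝ} (hB : B.Nonempty)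
    (hK : ∀ t ∈ B, K t ≠ ⊥) (hmax : ∀ m, IsGreatest B m → ¬ FiniteDimensional 𝕜 (K m)) :
    ∃ (l : ℕ → ℝ) (e : ℕ → H), Monotone l ∧ (∀ n, l n ∈ B) ∧ (∀ n, e n ∈ K (l n)) ∧
      Orthonormal 𝕜 e := by
  -- A greatest element has an infinite-dimensional space and may be repeated; without one there is
  -- a strictly increasing sequence.
  by_cases hg : ∃ m, IsGreatest B m
  · obtain ⟨m, hm⟩ := hg
    obtain ⟨f, hf⟩ := exists_orthonormal_nat (hmax m hm)
    exact ⟨fun _ => m, fun n => f n, monotone_const, fun _ => hm.1, fun n => (f n).2,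
      hf.comp_linearIsometry (K m).subtypeₗᵢ⟩
  · have : Nonempty B := hB.to_subtype
    have : NoMaxOrder B := ⟨fun a => by
      by_contra! hcon
      exact hg ⟨a, a.2, fun b hb => hcon ⟨b, hb⟩⟩⟩
    obtain ⟨f, hf⟩ := Nat.exists_strictMono B
    have hunit : ∀ n, ∃ v ∈ K (f n), ‖v‖ = 1 := by
      intro n
      obtain ⟨v, hv, hv0⟩ := Submodule.exists_mem_ne_zero_of_ne_bot (hK _ (f n).2)
      exact ⟨((‖v‖⁻¹ : ℝ) : 𝕜) • v, Submodule.smul_mem _ _ hv, by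
        rw [norm_smul, RCLike.norm_ofReal, abs_of_nonneg (by positivity),
          inv_mul_cancel₀ (norm_ne_zero_iff.2 hv0)]⟩
    choose e he hnorm using hunit
    refine ⟨fun n => f n, e, fun i j hij => hf.monotone hij, fun n => (f n).2, he, hnorm,
      fun i j hij => horth _ _ (fun h => hij (hf.injective (Subtype.ext h))) _ (he i) _ (he j)⟩

/-- A bilateral increasing sequence of parameters with orthonormal vectors. -/
theorem exists_bilateral_orthonormal {K : ℝ → Submodule 𝕜 H}
    (horth : ∀ s t, s ≠ t → ∀ x ∈ K s, ∀ y ∈ K t, inner 𝕜 x y = 0) {B : Set ℝ}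
    (hB : B.Nontrivial) (hK : ∀ t ∈ B, K t ≠ ⊥)
    (hmax : ∀ m, IsGreatest B m → ¬ FiniteDimensional 𝕜 (K m))
    (hmin : ∀ m, IsLeast B m → ¬ FiniteDimensional 𝕜 (K m)) :
    ∃ (l : ℤ → ℝ) (e : ℤ → H), (∀ k, l k ≤ l (k + 1)) ∧ l (-1) < l 0 ∧ (∀ k, l k ∈ B) ∧
      (∀ k, e k ∈ K (l k)) ∧ Orthonormal 𝕜 e := by
  -- Cutting `B` at `a` keeps both halves nonempty, passes the extremum hypotheses on to them, and
  -- forces a strict step from index `-1` to `0`.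
  obtain ⟨a, ha, b, hb, hab⟩ := hB.exists_lt
  obtain ⟨u, e, hu, huB, he, heo⟩ := exists_monotone_orthonormal horth (B := B ∩ Set.Ioi a)
    ⟨b, hb, hab⟩ (fun t ht => hK t ht.1) fun m hm => hmax m
      ⟨hm.1.1, fun x hx => (le_or_gt x a).elim (fun h => h.trans (le_of_lt hm.1.2))
        fun h => hm.2 ⟨hx, h⟩⟩
  -- The lower half is reflected by `t ↦ -t`, which turns minima into maxima.
  obtain ⟨v, f, hv, hvB, hf, hfo⟩ := exists_monotone_orthonormal (K := fun t => K (-t))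
    (fun s t hst => horth _ _ fun h => hst (neg_injective h)) (B := {t | -t ∈ B ∩ Set.Iic a})
    ⟨-a, by simpa using ha⟩ (fun t ht => hK _ ht.1) fun m hm => hmin (-m)
      ⟨hm.1.1, fun x hx => (le_or_gt x a).elim
        (fun h => neg_le.1 (hm.2 ⟨by simpa using hx, by simpa using h⟩))
        fun h => le_trans hm.1.2 h.le⟩
  have hlt : ∀ m n, -(v m) < u n := fun m n => lt_of_le_of_lt (hvB m).2 (huB n).2
  let l : ℤ → ℝ
    | Int.ofNat n => u n
    | Int.negSucc n => -(v n)
  let d : ℤ → H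
    | Int.ofNat n => e n
    | Int.negSucc n => f n
  refine ⟨l, d, ?_, hlt 0 0, ?_, ?_, ?_, ?_⟩
  · rintro (n | (_ | n))
    · exact hu (Nat.le_succ n)
    · exact (hlt 0 0).le
    · exact neg_le_neg (hv (Nat.le_succ n))
  · rintro (n | n)
    · exact (huB n).1
    · exact (hvB n).1
  · rintro (n | n)
    · exact he n
    · exact hf n
  · rintro (n | n)
    · exact heo.1 n
    · exact hfo.1 n
  · rintro (m | m) (n | n) hmn
    · exact heo.2 fun h => hmn (congrArg Int.ofNat h)
    · exact horth _ _ (hlt n m).ne' _ (he m) _ (hf n)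
    · exact horth _ _ (hlt m n).ne _ (hf m) _ (he n)
    · exact hfo.2 fun h => hmn (congrArg Int.negSucc h)

variable [CompleteSpace H]

theorem not_isLECPlastic_of_eigenvalues [Nontrivial H] {A : H →L[𝕜] H} (hA : IsSelfAdjoint A)
    {c : ℝ} (hc0 : 0 < c) (hc : ∀ x : H, c * ‖x‖ ^ 2 ≤ RCLike.re (inner 𝕜 x (A x)))
    {B : Set ℝ} (hBp : B ⊆ pointSpectrum A) (hB : B.Nontrivial)
    (hmax : ∀ m, IsGreatest B m → ¬ HasFiniteMultiplicity A m)
    (hmin : ∀ m, IsLeast B m → ¬ HasFiniteMultiplicity A m) :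
    ¬ IsLECPlastic 𝕜 (ellipsoid A) := by
  obtain ⟨q, r, hq, hqr, hr⟩ := exists_inv_sqrt hA hc0 hc
  obtain ⟨l, e, hl, hl0, hlB, he, heo⟩ := exists_bilateral_orthonormal (K := realEigenspace A)
    (fun s t hst x hx y hy => inner_realEigenspace hA.isSymmetric hst hx hy) hB
    (fun t ht => hBp ht) hmax hmin
  have hlpos : ∀ k, 0 < l k := fun k => pointSpectrum_pos hc0 hc (hBp (hlB k))
  let w : ℤ → 𝕜 →ₗᵢ[𝕜] H := fun k => LinearIsometry.toSpanSingleton 𝕜 H (heo.1 k)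
  have hwg : ∀ k g, w k g = g • e k := fun k g => rfl
  have hQw : ∀ k g, contCalc A q (w k g) = w k ((((√(l k))⁻¹ : ℝ) : 𝕜) * g) := by
    intro k g
    have hmem : l k ∈ realSpectrum A := mem_realSpectrum_of_eigen (heo.ne_zero k)
      (mem_realEigenspace.1 (he k))
    have h1 := contCalc_apply_of_eigen hA (t := ⟨l k, hmem⟩) (mem_realEigenspace.1 (he k)) q
    rw [hwg, hwg, map_smul, h1, hq, smul_smul, mul_comm]
  have hnorm : ∀ k g, ‖contCalc A q (w k g)‖ = (√(l k))⁻¹ * ‖g‖ := by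
    intro k g
    rw [hQw, LinearIsometry.norm_map, norm_mul, RCLike.norm_ofReal, abs_of_nonneg (by positivity)]
  refine not_isLECPlastic_of_contCalc_shift hA hqr hr (w := w) (fun j k hjk g g' => ?_)
    (fun k g => ⟨_, hQw k g⟩) (fun k g => ?_) ⟨-1, 1, ?_⟩
  · rw [hwg, hwg, inner_smul_left, inner_smul_right, heo.2 hjk, mul_zero, mul_zero]
  · rw [hnorm, hnorm]
    have := Real.sqrt_pos.2 (hlpos k)
    have := Real.sqrt_le_sqrt (hl k)
    gcongr
  · rw [hnorm, hnorm, norm_one, mul_one, mul_one]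
    have := Real.sqrt_pos.2 (hlpos (-1))
    have := Real.sqrt_lt_sqrt (hlpos (-1)).le hl0
    exact inv_strictAnti₀ ‹_› this

end EigenvectorSequences

/-! ### Subdividing an atomless measure. -/

section AtomlessMeasures

theorem continuous_measureReal_Iic {μ : Measure ℝ} [IsFiniteMeasure μ] (hatom : ∀ t, μ {t} = 0) :
    Continuous fun t => μ.real (Set.Iic t) := by
  have h : (fun t => μ.real (Set.Iic t)) =
      fun t => ∫ s, (Set.Iic t).indicator (fun _ => (1 : ℝ)) s ∂μ := by
    funext t
    rw [integral_indicator_const _ measurableSet_Iic, smul_eq_mul, mul_one]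
  rw [h, continuous_iff_continuousAt]
  intro t
  refine continuousAt_of_dominated (bound := fun _ => 1) (Eventually.of_forall fun x => ?_)
    (Eventually.of_forall fun x => ae_of_all _ fun s => ?_) (integrable_const _) ?_
  · exact (measurable_const.indicator measurableSet_Iic).aestronglyMeasurable
  · by_cases hs : s ∈ Set.Iic x <;> simp [hs]
  · have hae : ∀ᵐ s ∂μ, s ≠ t := by
      rw [ae_iff]
      simpa using hatom t
    filter_upwards [hae] with s hs
    rcases lt_or_gt_of_ne hs with hlt | hgt
    · refine continuousAt_const.congr (f := fun _ => (1 : ℝ)) ?_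
      filter_upwards [lt_mem_nhds hlt] with x hx
      rw [Set.indicator_of_mem (show s ∈ Set.Iic x from le_of_lt hx)]
    · refine continuousAt_const.congr (f := fun _ => (0 : ℝ)) ?_
      filter_upwards [gt_mem_nhds hgt] with x hx
      rw [Set.indicator_of_notMem (show s ∉ Set.Iic x from not_le.2 hx)]

/-- A nonzero finite atomless measure charges all the intervals of some bilateral subdivision. -/
theorem exists_bilateral_subdivision {μ : Measure ℝ} [IsFiniteMeasure μ] (hμ : μ ≠ 0)
    (hatom : ∀ t, μ {t} = 0) {a b : ℝ} (ha : μ (Set.Iic a) = 0) (hb : μ (Set.Ioi b) = 0) :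
    ∃ t : ℤ → ℝ, StrictMono t ∧ ∀ j k, j < k → 0 < μ (Set.Ioo (t j) (t k)) := by
  set F : ℝ → ℝ := fun t => μ.real (Set.Iic t) with hF
  have hcont : Continuous F := continuous_measureReal_Iic hatom
  have hmono : Monotone F := fun x y hxy => measureReal_mono (Set.Iic_subset_Iic.2 hxy)
  have hFa : F a = 0 := by simp [hF, measureReal_def, ha]
  have hFb : 0 < F b := by
    refine (measureReal_nonneg).lt_of_ne' fun h => hμ ?_
    rw [measureReal_eq_zero_iff] at h
    rw [← Measure.measure_univ_eq_zero, ← Set.Iic_union_Ioi (a := b)]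
    exact measure_union_null h hb
  have : Nonempty (Set.Ioo 0 (F b)) := (Set.nonempty_Ioo.2 hFb).to_subtype
  -- Points are found as preimages under the continuous distribution function of increasing values
  -- in `(0, F b)`.
  obtain ⟨g, hg⟩ := Int.exists_strictMono (Set.Ioo 0 (F b))
  have hrange : ∀ k, ∃ t, F t = g k := fun k =>
    mem_range_of_exists_le_of_exists_ge hcont ⟨a, hFa.le.trans (g k).2.1.le⟩ ⟨b, (g k).2.2.le⟩
  choose t ht using hrange
  refine ⟨t, fun j k hjk => ?_, fun j k hjk => ?_⟩
  · refine hmono.reflect_lt ?_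
    rw [ht, ht]
    exact hg hjk
  · have hlt : F (t j) < F (t k) := by
      rw [ht, ht]
      exact hg hjk
    rw [pos_iff_ne_zero]
    intro h0
    have hle : μ (Set.Iic (t k)) ≤ μ (Set.Iic (t j)) := by
      have hsub : Set.Iic (t k) ⊆ Set.Iic (t j) ∪ (Set.Ioo (t j) (t k) ∪ {t k}) := by
        intro x hx
        rcases le_or_gt x (t j) with h | h
        · exact Or.inl h
        · rcases (show x ≤ t k from hx).lt_or_eq with h' | h'
          · exact Or.inr (Or.inl ⟨h, h'⟩)
          · exact Or.inr (Or.inr h')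
      calc μ (Set.Iic (t k)) ≤ _ := measure_mono hsub
        _ ≤ μ (Set.Iic (t j)) + (μ (Set.Ioo (t j) (t k)) + μ {t k}) :=
          (measure_union_le _ _).trans (add_le_add_right (measure_union_le _ _) _)
        _ = μ (Set.Iic (t j)) := by rw [h0, hatom, add_zero, add_zero]
    exact hlt.not_ge (ENNReal.toReal_mono (measure_ne_top _ _) hle)

end AtomlessMeasures

/-! ### Infinite-dimensional separable Hilbert spaces are copies of `ℓ²`. -/

section SeparableHilbert

variable {𝕜 E : Type*} [RCLike 𝕜] [NormedAddCommGroup E] [InnerProductSpace 𝕜 E]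

/-- Orthonormal vectors lie at distance `√2 > 1`, so the balls of radius `1/2` are disjoint. -/
theorem Orthonormal.countable_of_separable [TopologicalSpace.SeparableSpace E] {ι : Type*}
    {v : ι → E} (hv : Orthonormal 𝕜 v) : Countable ι := by
  have hdisj : Pairwise (Function.onFun Disjoint fun i => Metric.ball (v i) (1 / 2)) := by
    intro i j hij
    refine Metric.ball_disjoint_ball ?_
    have h : dist (v i) (v j) ^ 2 = 2 := by
      rw [dist_eq_norm, @norm_sub_sq 𝕜, hv.2 hij, hv.1, hv.1]
      norm_num
    nlinarith [dist_nonneg (x := v i) (y := v j)]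
  have h := Set.PairwiseDisjoint.countable_of_isOpen (a := Set.univ)
    (fun i _ j _ hij => hdisj hij) (fun i _ => Metric.isOpen_ball)
    (fun i _ => ⟨v i, Metric.mem_ball_self (by norm_num)⟩)
  exact Set.countable_univ_iff.1 h

theorem nonempty_linearIsometryEquiv_l2 [CompleteSpace E] [TopologicalSpace.SeparableSpace E]
    (hE : ¬ FiniteDimensional 𝕜 E) : Nonempty (lp (fun _ : ℕ => 𝕜) 2 ≃ₗᵢ[𝕜] E) := by
  obtain ⟨s, b, -⟩ := exists_hilbertBasis 𝕜 E
  have : Countable s := b.orthonormal.countable_of_separable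
  have : Infinite s := by
    by_contra h
    rw [not_infinite_iff_finite] at h
    have := Fintype.ofFinite s
    exact hE (Module.Finite.of_basis b.toOrthonormalBasis.toBasis)
  obtain ⟨f⟩ := nonempty_equiv_of_countable (α := ℕ) (β := s)
  let c : HilbertBasis ℕ 𝕜 E := HilbertBasis.mk (b.orthonormal.comp f f.injective) (by
    rw [f.surjective.range_comp b, b.dense_span])
  exact ⟨c.repr.symm⟩

end SeparableHilbert

/-! ### Spectral subspaces of intervals; failure of plasticity from continuous spectrum. -/

section SpectrumBump

variable {𝕜 H : Type*} [RCLike 𝕜] [NormedAddCommGroup H] [InnerProductSpace 𝕜 H]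

/-- The bump function supported in the interval `(a, b)`. -/
def spectrumBump (A : H →L[𝕜] H) (a b : ℝ) : C(realSpectrum A, ℝ) :=
  ⟨fun s => max 0 (min ((s : ℝ) - a) (b - s)), by fun_prop⟩

theorem spectrumBump_ne_zero_iff {A : H →L[𝕜] H} {a b : ℝ} {s : realSpectrum A} :
    spectrumBump A a b s ≠ 0 ↔ (s : ℝ) ∈ Set.Ioo a b := by
  have : spectrumBump A a b s = max 0 (min ((s : ℝ) - a) (b - s)) := rfl
  rw [this, ne_eq, max_eq_left_iff, not_le, lt_min_iff, sub_pos, sub_pos, Set.mem_Ioo]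

end SpectrumBump

section ContinuousShift

variable {𝕜 H : Type*} [RCLike 𝕜] [NormedAddCommGroup H] [InnerProductSpace 𝕜 H] [CompleteSpace H]

/-- The closure of the range of `f(A)`. -/
def calcRange (A : H →L[𝕜] H) (f : C(realSpectrum A, ℝ)) : Submodule 𝕜 H :=
  ((contCalc A f : H →L[𝕜] H) : H →ₗ[𝕜] H).range.topologicalClosure

variable {A : H →L[𝕜] H}

theorem calcRange_induction {f : C(realSpectrum A, ℝ)} {P : H → Prop} (hP : IsClosed {x | P x})
    (h : ∀ y, P (contCalc A f y)) {x : H} (hx : x ∈ calcRange A f) : P x :=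
  closure_minimal (by rintro _ ⟨y, rfl⟩; exact h y) hP hx

theorem contCalc_mem_calcRange (f : C(realSpectrum A, ℝ)) (x : H) :
    contCalc A f x ∈ calcRange A f :=
  Submodule.le_topologicalClosure _ ⟨x, rfl⟩

theorem isClosed_calcRange (f : C(realSpectrum A, ℝ)) : IsClosed (calcRange A f : Set H) :=
  Submodule.isClosed_topologicalClosure _

variable [Nontrivial H]

theorem contCalc_mapsTo_calcRange (hA : IsSelfAdjoint A) (f g : C(realSpectrum A, ℝ)) {x : H}
    (hx : x ∈ calcRange A f) : contCalc A g x ∈ calcRange A f := by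
  refine calcRange_induction (P := fun x => contCalc A g x ∈ calcRange A f)
    ((isClosed_calcRange f).preimage (contCalc A g).continuous) (fun y => ?_) hx
  rw [contCalc_comm_apply hA]
  exact contCalc_mem_calcRange f _

theorem inner_calcRange (hA : IsSelfAdjoint A) {f g : C(realSpectrum A, ℝ)} (hfg : f * g = 0)
    {x y : H} (hx : x ∈ calcRange A f) (hy : y ∈ calcRange A g) : inner 𝕜 x y = 0 := by
  refine calcRange_induction (P := fun x => inner 𝕜 x y = 0)
    (isClosed_eq (by fun_prop) continuous_const) (fun x => ?_) hx
  refine calcRange_induction (P := fun y => inner 𝕜 (contCalc A f x) y = 0)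
    (isClosed_eq (by fun_prop) continuous_const) (fun y => ?_) hy
  rw [inner_contCalc_left hA, ← contCalc_mul_apply hA, hfg, map_zero]
  exact inner_zero_right _

/-- Pointwise bounds of `q` on the support of `f` bound the form of `q(A) ^ 2` on the range of
`f(A)`. -/
theorem norm_contCalc_le_of_mem_calcRange (hA : IsSelfAdjoint A) {f p q : C(realSpectrum A, ℝ)}
    (hle : ∀ t, f t ≠ 0 → |p t| ≤ |q t|) {x : H} (hx : x ∈ calcRange A f) :
    ‖contCalc A p x‖ ≤ ‖contCalc A q x‖ := by
  refine calcRange_induction (P := fun x => ‖contCalc A p x‖ ≤ ‖contCalc A q x‖)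
    (isClosed_le (by fun_prop) (by fun_prop)) (fun y => ?_) hx
  refine (sq_le_sq₀ (norm_nonneg _) (norm_nonneg _)).1 ?_
  rw [← contCalc_mul_apply hA, ← contCalc_mul_apply hA, norm_contCalc_apply_sq hA,
    norm_contCalc_apply_sq hA]
  refine re_inner_contCalc_mono hA (fun t => ?_) y
  simp only [ContinuousMap.mul_apply]
  by_cases hf : f t = 0
  · simp [hf]
  · have h1 := sq_le_sq.2 (hle t hf)
    nlinarith [mul_le_mul_of_nonneg_right h1 (sq_nonneg (f t))]

/-- On a finite-dimensional invariant subspace `A` would be diagonalizable, but `f(A) ψ` is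
orthogonal to every eigenvector. -/
theorem not_finiteDimensional_calcRange (hA : IsSelfAdjoint A) {ψ : H}
    (horth : ∀ (t : ℝ) (v : H), A v = (t : 𝕜) • v → inner 𝕜 v ψ = 0) {f : C(realSpectrum A, ℝ)}
    (hf : contCalc A f ψ ≠ 0) : ¬ FiniteDimensional 𝕜 (calcRange A f) := by
  intro hfin
  have hmaps : ∀ x ∈ calcRange A f, (A : H →ₗ[𝕜] H) x ∈ calcRange A f := by
    intro x hx
    have h := contCalc_mapsTo_calcRange hA f (polyOnSpectrum A X) hx
    rwa [contCalc_X hA] at h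
  let T : calcRange A f →ₗ[𝕜] calcRange A f := (A : H →ₗ[𝕜] H).restrict hmaps
  have hT : T.IsSymmetric := fun x y => hA.isSymmetric (x : H) (y : H)
  have hbot := hT.orthogonalComplement_iSup_eigenspaces_eq_bot
  let φ : calcRange A f := ⟨contCalc A f ψ, contCalc_mem_calcRange f ψ⟩
  have hφ : φ ∈ (⨆ μ, Module.End.eigenspace T μ)ᗮ := by
    rw [← Submodule.iInf_orthogonal, Submodule.mem_iInf]
    intro μ v hv
    by_cases hv0 : v = 0
    · rw [hv0, inner_zero_left]
    have hreal := hT.conj_eigenvalue_eq_self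
      (Module.End.hasEigenvalue_of_hasEigenvector ⟨hv, hv0⟩)
    obtain ⟨t, rfl⟩ := RCLike.conj_eq_iff_real.1 hreal
    have hAv : A (v : H) = (t : 𝕜) • (v : H) :=
      congrArg Subtype.val (Module.End.mem_eigenspace_iff.1 hv)
    have hv0' : (v : H) ≠ 0 := fun h => hv0 (Subtype.ext h)
    rw [Submodule.coe_inner]
    change inner 𝕜 (v : H) (contCalc A f ψ) = 0
    rw [← inner_contCalc_left hA,
      contCalc_apply_of_eigen hA (t := ⟨t, mem_realSpectrum_of_eigen hv0' hAv⟩) hAv,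
      inner_smul_left, horth t _ hAv, mul_zero]
  rw [hbot, Submodule.mem_bot] at hφ
  exact hf (congrArg Subtype.val hφ)

theorem contCalc_spectrumBump_ne_zero (hA : IsSelfAdjoint A) {ψ : H}
    {ν : Measure (realSpectrum A)} (hν : RepresentsVector A ψ ν) {a b : ℝ}
    (hab : 0 < ν (Subtype.val ⁻¹' Set.Ioo a b)) : contCalc A (spectrumBump A a b) ψ ≠ 0 := by
  have hfin := hν.isFinite
  intro h0
  have h := hν.norm_contCalc_sq hA (spectrumBump A a b)
  rw [h0, norm_zero, zero_pow two_ne_zero, eq_comm,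
    integral_eq_zero_iff_of_nonneg (fun t => sq_nonneg _)
      (integrable_continuousMap ν (spectrumBump A a b ^ 2))] at h
  refine hab.ne' ?_
  refine measure_mono_null (fun s hs => ?_) h
  exact fun h' => spectrumBump_ne_zero_iff.2 hs (by simpa using h')

theorem not_isLECPlastic_of_contSubspace [TopologicalSpace.SeparableSpace H]
    (hA : IsSelfAdjoint A) {c : ℝ} (hc0 : 0 < c)
    (hc : ∀ x : H, c * ‖x‖ ^ 2 ≤ RCLike.re (inner 𝕜 x (A x))) (hcont : contSubspace A ≠ ⊥) :
    ¬ IsLECPlastic 𝕜 (ellipsoid A) := by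
  obtain ⟨ψ, ν, hψ, hν, hatom⟩ := exists_representsVector_of_contSubspace_ne_bot hA hcont
  have hfin := hν.isFinite
  have hm : Measurable (Subtype.val : realSpectrum A → ℝ) := measurable_subtype_coe
  obtain ⟨q, r, hq, hqr, hr⟩ := exists_inv_sqrt hA hc0 hc
  obtain ⟨t, ht, htpos⟩ : ∃ t : ℤ → ℝ, StrictMono t ∧
      ∀ j k, j < k → 0 < ν (Subtype.val ⁻¹' Set.Ioo (t j) (t k)) := by
    obtain ⟨a, ha⟩ := (isCompact_realSpectrum A).bddBelow
    obtain ⟨b, hb⟩ := (isCompact_realSpectrum A).bddAbove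
    have hne : ν.map Subtype.val ≠ 0 := by
      intro h0
      have h1 := hν.norm_sq hA
      rw [measureReal_def, ← Set.preimage_univ (f := Subtype.val),
        ← Measure.map_apply hm MeasurableSet.univ, h0] at h1
      exact hψ (by simpa using h1)
    have hat : ∀ x, ν.map Subtype.val {x} = 0 := by
      intro x
      rw [Measure.map_apply hm (measurableSet_singleton x)]
      have hsub : (Subtype.val ⁻¹' {x} : Set (realSpectrum A)).Subsingleton :=
        fun y hy z hz => Subtype.ext (Eq.trans hy (Eq.symm hz))
      rcases hsub.eq_empty_or_singleton with h | ⟨y, h⟩ <;> rw [h]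
      · exact measure_empty
      · exact hatom y
    -- The half-line up to `a - 1` misses the spectrum, whereas `a` itself may belong to it.
    have hIic : ν.map Subtype.val (Set.Iic (a - 1)) = 0 := by
      rw [Measure.map_apply hm measurableSet_Iic]
      convert measure_empty (μ := ν)
      ext s
      have h1 : a ≤ s := ha s.2
      simp only [Set.mem_preimage, Set.mem_Iic, Set.mem_empty_iff_false, iff_false]
      linarith
    have hIoi : ν.map Subtype.val (Set.Ioi b) = 0 := by
      rw [Measure.map_apply hm measurableSet_Ioi]
      convert measure_empty (μ := ν)
      ext s
      have h1 : s ≤ b := hb s.2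
      simp only [Set.mem_preimage, Set.mem_Ioi, Set.mem_empty_iff_false, iff_false]
      linarith
    obtain ⟨t, ht, htpos⟩ := exists_bilateral_subdivision hne hat hIic hIoi
    refine ⟨t, ht, fun j k hjk => ?_⟩
    have := htpos j k hjk
    rwa [Measure.map_apply hm measurableSet_Ioo] at this
  have htp : ∀ k, 0 < t k := by
    intro k
    obtain ⟨s, hs⟩ := nonempty_of_measure_ne_zero (htpos (k - 1) k (by omega)).ne'
    exact hc0.trans_le ((le_of_mem_realSpectrum hc s.2).trans hs.2.le)
  -- Using only every other interval leaves gaps, which make the comparison between consecutive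
  -- blocks strict.
  let f : ℤ → C(realSpectrum A, ℝ) := fun k => spectrumBump A (t (2 * k)) (t (2 * k + 1))
  have horth := fun (s : ℝ) (v : H) (hv : A v = (s : 𝕜) • v) =>
    hν.inner_eigen_eq_zero hA hatom hv
  have hiso : ∀ k, Nonempty (lp (fun _ : ℕ => 𝕜) 2 ≃ₗᵢ[𝕜] calcRange A (f k)) := by
    intro k
    have : CompleteSpace (calcRange A (f k)) := (isClosed_calcRange _).completeSpace_coe
    exact nonempty_linearIsometryEquiv_l2 (not_finiteDimensional_calcRange hA horth
      (contCalc_spectrumBump_ne_zero hA hν (htpos _ _ (by omega))))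
  let i := fun k => (hiso k).some
  let w : ℤ → lp (fun _ : ℕ => 𝕜) 2 →ₗᵢ[𝕜] H := fun k =>
    (calcRange A (f k)).subtypeₗᵢ.comp (i k).toLinearIsometry
  have hwmem : ∀ k g, w k g ∈ calcRange A (f k) := fun k g => (i k g).2
  have hwsurj : ∀ k, ∀ x ∈ calcRange A (f k), ∃ g, x = w k g := fun k x hx =>
    ⟨(i k).symm ⟨x, hx⟩, (congrArg Subtype.val ((i k).apply_symm_apply ⟨x, hx⟩)).symm⟩
  have hconst : ∀ (a : ℝ) (x : H), 0 ≤ a →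
      ‖contCalc A (ContinuousMap.const _ a) x‖ = a * ‖x‖ := by
    intro a x ha
    have h1 : ContinuousMap.const (realSpectrum A) a = a • (1 : C(realSpectrum A, ℝ)) := by
      ext s; simp
    rw [h1, map_smul, contCalc_one hA, real_smul_clm_apply, norm_smul, RCLike.norm_ofReal,
      abs_of_nonneg ha]
    rfl
  have hupper : ∀ k g, ‖contCalc A q (w k g)‖ ≤ (√(t (2 * k)))⁻¹ * ‖g‖ := by
    intro k g
    rw [← (w k).norm_map, ← hconst _ _ (by positivity)]
    refine norm_contCalc_le_of_mem_calcRange hA (fun s hs => ?_) (hwmem k g)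
    have hs' := spectrumBump_ne_zero_iff.1 hs
    rw [hq, ContinuousMap.const_apply, abs_of_nonneg (by positivity), abs_of_nonneg (by positivity)]
    exact inv_anti₀ (Real.sqrt_pos.2 (htp _)) (Real.sqrt_le_sqrt hs'.1.le)
  have hlower : ∀ k g, (√(t (2 * k + 1)))⁻¹ * ‖g‖ ≤ ‖contCalc A q (w k g)‖ := by
    intro k g
    rw [← (w k).norm_map, ← hconst _ _ (by positivity)]
    refine norm_contCalc_le_of_mem_calcRange hA (fun s hs => ?_) (hwmem k g)
    have hs' := spectrumBump_ne_zero_iff.1 hs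
    rw [hq, ContinuousMap.const_apply, abs_of_nonneg (by positivity), abs_of_nonneg (by positivity)]
    exact inv_anti₀ (Real.sqrt_pos.2 ((htp (2 * k)).trans hs'.1)) (Real.sqrt_le_sqrt hs'.2.le)
  have hstep : ∀ k, (√(t (2 * (k + 1))))⁻¹ < (√(t (2 * k + 1)))⁻¹ := fun k =>
    inv_strictAnti₀ (Real.sqrt_pos.2 (htp _)) (Real.sqrt_lt_sqrt (htp _).le (ht (by omega)))
  refine not_isLECPlastic_of_contCalc_shift hA hqr hr (w := w) (fun j k hjk g g' => ?_)
    (fun k g => hwsurj k _ (contCalc_mapsTo_calcRange hA _ _ (hwmem k g))) (fun k g => ?_) ?_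
  · refine inner_calcRange hA ?_ (hwmem j g) (hwmem k g')
    ext s
    simp only [ContinuousMap.mul_apply, ContinuousMap.zero_apply, mul_eq_zero]
    by_contra! hne
    have h1 := spectrumBump_ne_zero_iff.1 hne.1
    have h2 := spectrumBump_ne_zero_iff.1 hne.2
    rcases lt_or_gt_of_ne hjk with hlt | hlt
    · have := ht.monotone (show 2 * j + 1 ≤ 2 * k by omega)
      linarith [h1.2, h2.1]
    · have := ht.monotone (show 2 * k + 1 ≤ 2 * j by omega)
      linarith [h1.1, h2.2]
  · refine (hupper (k + 1) g).trans (le_trans ?_ (hlower k g))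
    have := (hstep k).le
    gcongr
  -- The gap makes the decrease strict on any nonzero vector of a block; `f 0 (A) ψ` provides one.
  · obtain ⟨g, hg⟩ := hwsurj 0 _ (contCalc_mem_calcRange (f 0) ψ)
    have hg0 : g ≠ 0 := by
      rintro rfl
      rw [map_zero] at hg
      exact contCalc_spectrumBump_ne_zero hA hν (htpos _ _ (by omega)) hg
    refine ⟨0, g, (hupper (0 + 1) g).trans_lt (lt_of_lt_of_le ?_ (hlower 0 g))⟩
    exact mul_lt_mul_of_pos_right (hstep 0) (norm_pos_iff.2 hg0)

end ContinuousShift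

end

theorem theorem3p8 {𝕜 H : Type*} [RCLike 𝕜] [NormedAddCommGroup H] [InnerProductSpace 𝕜 H]
    [CompleteSpace H] [TopologicalSpace.SeparableSpace H] (hdim : ¬ FiniteDimensional 𝕜 H)
    (A : H →L[𝕜] H) (hA : IsSelfAdjoint A)
    (hpos : ∃ c : ℝ, 0 < c ∧ ∀ x : H, ‖x‖ = 1 → c ≤ RCLike.re (inner 𝕜 (A x) x)) :
    IsLECPlastic 𝕜 (ellipsoid A) ↔
      contSpectrum A hA = ∅ ∧
      ∀ B : Set ℝ, B ⊆ pointSpectrum A → B.Nontrivial →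
        (∃ m, IsGreatest B m ∧ HasFiniteMultiplicity A m) ∨
        (∃ m, IsLeast B m ∧ HasFiniteMultiplicity A m) := by
  have hnt : Nontrivial H := by
    by_contra h
    rw [not_nontrivial_iff_subsingleton] at h
    exact hdim inferInstance
  obtain ⟨c, hc0, hc1⟩ := hpos
  have hc : ∀ x : H, c * ‖x‖ ^ 2 ≤ RCLike.re (inner 𝕜 x (A x)) := fun x =>
    (coercive_of_unit hc1 x).trans_eq (congrArg _ (hA.isSymmetric x x))
  rw [contSpectrum_eq_empty_iff]
  refine ⟨fun hE => ⟨?_, fun B hBp hB => ?_⟩, fun h => isLECPlastic_of_conditions hA hc0 hc h.1 h.2⟩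
  · by_contra hcont
    exact not_isLECPlastic_of_contSubspace hA hc0 hc hcont hE
  · by_contra! hcon
    exact not_isLECPlastic_of_eigenvalues hA hc0 hc hBp hB hcon.1 hcon.2 hE
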